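/- **Setting.** Let $d\ge 1$ and let $f$ be a probability density on $\mathbb{R}^d$ with $\int\|x\|f(x)\,dx<\infty$. For each $N\ge1$ let $x(1),\dots,x(N)$ be independent points with density $f$. The energy of element $i$ is $E(i)=\frac1N\sum_{j=1}^N\|x(i)-x(j)\|$. A medoid is an element $x(m^*)$ of minimum energy $E^*=E(m^*)$, and $e(i)=\|x(i)-x(m^*)\|$. "W.h.p." means with probability $1-O(1/N)$ as a function of the sample size $N\ge 1$. **Algorithm `trimed`.** Start with lower bounds $l(i)=0$ for all $i$ and with $E^{cl}=\infty$. Process the indices $i\in\{1,\dots,N\}$ in uniformly random order (independent of the sample). If $l(i)\ge E^{cl}$, then $i$ is eliminated. Otherwise $i$ is *computed*: put $l(i)\leftarrow E(i)$; if $l(i)<E^{cl}$, put $m^{cl}\leftarrow i$ and $E^{cl}\leftarrow l(i)$; then for all $j$ put $l(j)\leftarrow\max\bigl(l(j),\,|l(i)-\|x(i)-x(j)\||\bigr)$. **Theorem.** Let $\alpha,\beta,\rho,\delta_0,\delta_1>0$ be constants, and let $(\tau_N)_{N\ge1}$ be real numbers with $\tau_N\le N^{-2/(3d)}$ (for instance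 $\tau_N=0$ for all $N$). Suppose that w.h.p. there is a medoid $x(m^*)$ of the sample such that 1. $\delta_0\le f(x)\le\delta_1$ for all $x$ with $\|x-x(m^*)\|\le\rho$, and 2. every $i\in\{1,\dots,N\}$ with $e(i)\ge\tau_N$ satisfies $$E(i)-E^*\ \ge\ \begin{cases}\alpha\, e(i)^2 & \text{if } e(i)\le\rho,\\ \alpha\rho^2&\text{if } e(i)>\rho,\end{cases}\qquad\text{and}\qquad E(i)-E^*\le\beta\, e(i)^2\ \text{ if } e(i)\le\rho .$$ Then the expected number of elements computed by `trimed` (over the sample and the processing order) is $$O\!\left(\Bigl(V_d[1]\,\delta_1+d\bigl(\tfrac4\alpha\bigr)^d\Bigr)N^{1/2}\right)\qquad (N\to\infty),$$ where $V_d[1]=\pi^{d/2}/\Gamma(\tfrac d2+1)$ is the volume of the unit ball of $\mathbb{R}^d$. The constant hidden in the $O$ is absolute: there is a universal $C$ such that, for all $d,f,\alpha,\beta,\rho,\delta_0,\delta_1,(\tau_N)$ as above, the expected number is at most $C\bigl(V_d[1]\delta_1+d(4/\alpha)^d\bigr)N^{1/2}$ for all sufficiently large $N$ (how large may depend on all the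 data). -/

import Mathlib

open MeasureTheory Filter
open scoped ENNReal

namespace Trimed

noncomputable section

/-- The energy of element `i`: its mean distance to the elements of the set (itself included). -/
def energy {X : Type*} [PseudoMetricSpace X] {N : ℕ} (x : Fin N → X) (i : Fin N) : ℝ :=
  (1 / (N : ℝ)) * ∑ j, dist (x i) (x j)

/-- `m` indexes a medoid: an element of minimum energy. -/
def IsMedoid {X : Type*} [PseudoMetricSpace X] {N : ℕ} (x : Fin N → X) (m : Fin N) : Prop :=
  ∀ i, energy x m ≤ energy x i

/-- The variables of the algorithm, together with the record of the elements computed so far. -/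
structure State (N : ℕ) where
  /-- lower bounds `l` on the energies -/
  lower : Fin N → ℝ
  /-- index of the best medoid candidate found so far -/
  best : Option (Fin N)
  /-- energy of the best candidate, `⊤` if there is none -/
  bestEnergy : EReal
  /-- the elements that passed the bound test and were computed -/
  computed : Finset (Fin N)

/-- The initial state: zero lower bounds, no candidate, candidate energy `∞`. -/
def State.init (N : ℕ) : State N where
  lower := fun _ => 0
  best := none
  bestEnergy := ⊤
  computed := ∅

open Classical in
/-- One pass of the main loop, for the element `i`. If `l(i) < E^cl`, all distances from `x i` are
computed, `l(i)` is set to the energy of `i`, the candidate is replaced if `l(i) < E^cl` for this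
new value, and `l(j)` becomes `max (l(j), |l(i) - d(j)|)` for all `j`.
Otherwise `i` is eliminated and nothing changes. -/
def step {X : Type*} [PseudoMetricSpace X] {N : ℕ} (x : Fin N → X) (s : State N) (i : Fin N) :
    State N :=
  if (s.lower i : EReal) < s.bestEnergy then
    let d : Fin N → ℝ := fun j => dist (x i) (x j)
    let li : ℝ := (1 / (N : ℝ)) * ∑ j, d j
    let l : Fin N → ℝ := Function.update s.lower i li
    { lower := fun j => max (l j) |li - d j|
      best := if (li : EReal) < s.bestEnergy then some i else s.best
      bestEnergy := if (li : EReal) < s.bestEnergy then (li : EReal) else s.bestEnergy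
      computed := insert i s.computed }
  else s

/-- The final state of the algorithm when the elements are processed in the order
`σ 0, σ 1, …, σ (N - 1)`. -/
def run {X : Type*} [PseudoMetricSpace X] {N : ℕ} (x : Fin N → X) (σ : Equiv.Perm (Fin N)) :
    State N :=
  (List.ofFn fun k => σ k).foldl (step x) (State.init N)

/-- The number of elements computed, i.e. not eliminated by the bound test. -/
def numComputed {X : Type*} [PseudoMetricSpace X] {N : ℕ} (x : Fin N → X)
    (σ : Equiv.Perm (Fin N)) : ℕ :=
  (run x σ).computed.card

/-- The probability distribution on `ℝ^d` with density `f`. -/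
def law {d : ℕ} (f : EuclideanSpace ℝ (Fin d) → ℝ) : Measure (EuclideanSpace ℝ (Fin d)) :=
  volume.withDensity fun x => ENNReal.ofReal (f x)

/-- The joint distribution of `N` independent points with density `f`. -/
def sampleLaw {d : ℕ} (f : EuclideanSpace ℝ (Fin d) → ℝ) (N : ℕ) :
    Measure (Fin N → EuclideanSpace ℝ (Fin d)) :=
  Measure.pi fun _ => law f

/-- The expected number of elements computed, over `N` independent points with density `f` and an
independent uniformly random processing order. -/
def expectedComputed {d : ℕ} (f : EuclideanSpace ℝ (Fin d) → ℝ) (N : ℕ) : ℝ≥0∞ :=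
  ∫⁻ x, (∑ σ : Equiv.Perm (Fin N), (numComputed x σ : ℝ≥0∞)) / (N.factorial : ℝ≥0∞)
    ∂(sampleLaw f N)

/-- The assumptions on the sample `x` with medoid `x m`: the density is between `δ₀` and `δ₁` on
the closed `ρ`-ball around the medoid, and the excess energy of every element whose distance from
the medoid is at least `τ` obeys the quadratic lower and upper bounds. -/
def GoodAt {d N : ℕ} (f : EuclideanSpace ℝ (Fin d) → ℝ) (α β ρ δ₀ δ₁ τ : ℝ)
    (x : Fin N → EuclideanSpace ℝ (Fin d)) (m : Fin N) : Prop :=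
  (∀ y, ‖y - x m‖ ≤ ρ → δ₀ ≤ f y ∧ f y ≤ δ₁) ∧
  ∀ i, τ ≤ ‖x i - x m‖ →
    (‖x i - x m‖ ≤ ρ → α * ‖x i - x m‖ ^ 2 ≤ energy x i - energy x m) ∧
    (ρ < ‖x i - x m‖ → α * ρ ^ 2 ≤ energy x i - energy x m) ∧
    (‖x i - x m‖ ≤ ρ → energy x i - energy x m ≤ β * ‖x i - x m‖ ^ 2)

/-- The samples of size `N` for which the assumptions hold at a medoid. -/
def goodSamples {d : ℕ} (f : EuclideanSpace ℝ (Fin d) → ℝ) (α β ρ δ₀ δ₁ τ : ℝ) (N : ℕ) :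
    Set (Fin N → EuclideanSpace ℝ (Fin d)) :=
  {x | ∃ m, IsMedoid x m ∧ GoodAt f α β ρ δ₀ δ₁ τ x m}

/-- With high probability: for samples of every size `N ≥ 1` the event `A N` has probability
`1 - O(1/N)`. -/
def WHP {d : ℕ} (f : EuclideanSpace ℝ (Fin d) → ℝ)
    (A : (N : ℕ) → Set (Fin N → EuclideanSpace ℝ (Fin d))) : Prop :=
  ∃ K : ℝ, ∀ N : ℕ, 1 ≤ N → sampleLaw f N (A N)ᶜ ≤ ENNReal.ofReal (K / N)

/-- The volume of the unit ball of `ℝ^d`. -/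
def unitBallVolume (d : ℕ) : ℝ :=
  Real.pi ^ ((d : ℝ) / 2) / Real.Gamma ((d : ℝ) / 2 + 1)

end

end Trimed

/-! If a computed element a precedes a computed element b, then b passed the bound test although a
had already raised l(b). Hence |E(a) - ‖x(a) - x(b)‖| < E(c) for every c processed before b,
eliminated or not, and so ‖x(a) - x(b)‖ > E(a) - E(c). Once some c very close to the medoid has been
processed, the quadratic bounds turn this into separation α e(a)²/2 from every later computed b, and
volume packing leaves at most a multiple of (4/α)^d r^(-d) computed elements at distance between r
and a fixed R. Elements with e ≤ r are counted by the density: about N δ₁ V_d r^d. The radius r =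
N^(-1/(2d)) puts both at order N^(1/2).

One stage is not enough. A c that is closer than r by a power of N, as needed to beat β/α with high
probability, shows up only after more than N^(1/2) elements, too many to count all of them. So there
are two stages. After N^(2/5) elements some c serves for the radius r₁ = N^(-1/(5d)): packing leaves
O(N^(1/5)) computed elements between r₁ and R, and few of the first N^(3/5) elements lie within r₁.
After N^(3/5) elements some c serves for r₀ = N^(-1/(2d)). Beyond R the excess energy is at least
proportional to the distance, so each dyadic shell holds boundedly many computed elements; few
points have norm above N.

By exchangeability the order may be taken to be the index order. The medoid depends on the sample,
so each probabilistic estimate is made for every index m, the other points being independent of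
x(m); the union bound costs a factor N, which exponential tails absorb. Bad events have probability
O(1/N) and at most N elements are computed, so they contribute O(1).

The main lemmas are `exists_computed_positions`, `card_le_of_quadratic_separation`,
`measure_many_le` and `measure_none_le`; `card_le_of_goodAt` combines the deterministic part. -/

namespace Trimed

/-! ### Separation of the computed elements -/

section Algorithm

variable {X : Type*} [PseudoMetricSpace X] {N : ℕ}

/-- The triangle inequality averaged over all k. This is what makes the bounds of the algorithm
valid. -/
theorem abs_energy_sub_dist_le (x : Fin N → X) (i j : Fin N) :
    |energy x i - dist (x i) (x j)| ≤ energy x j := by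
  have hN : (0 : ℝ) < N := by exact_mod_cast i.pos
  have key : ∀ c : ℝ, c = (1 / (N : ℝ)) * ∑ _k : Fin N, c := by
    intro c
    simp
    field_simp
  unfold energy
  rw [abs_le]
  constructor
  · rw [neg_le_iff_add_nonneg, ← sub_nonneg]
    rw [key (dist (x i) (x j)), ← mul_sub, ← Finset.sum_sub_distrib, ← mul_add,
      ← Finset.sum_add_distrib, sub_zero]
    refine mul_nonneg (by positivity) (Finset.sum_nonneg fun k _ => ?_)
    have := dist_triangle (x i) (x k) (x j)
    rw [dist_comm (x k)] at this
    linarith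
  · rw [key (dist (x i) (x j)), ← mul_sub, ← Finset.sum_sub_distrib]
    refine mul_le_mul_of_nonneg_left (Finset.sum_le_sum fun k _ => ?_) (by positivity)
    have := dist_triangle (x i) (x j) (x k)
    linarith

/-- What the state of the algorithm satisfies after the elements of the list `l` are processed. -/
structure Invariant (x : Fin N → X) (l : List (Fin N)) (s : State N) : Prop where
  computed_mem : ∀ i ∈ s.computed, i ∈ l
  bestEnergy_le : ∀ i ∈ l, s.bestEnergy ≤ (energy x i : EReal)
  lower_le : ∀ j, s.lower j ≤ energy x j
  le_lower : ∀ i ∈ s.computed, ∀ j, |energy x i - dist (x i) (x j)| ≤ s.lower j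
  separated : ∀ l₁ b l₂, l = l₁ ++ b :: l₂ → b ∈ s.computed → ∀ a ∈ l₁, a ∈ s.computed →
    ∀ c ∈ l₁, |energy x a - dist (x a) (x b)| < energy x c

theorem Invariant.init (x : Fin N → X) : Invariant x [] (State.init N) where
  computed_mem := by simp [State.init]
  bestEnergy_le := by simp
  lower_le j := by
    simp only [State.init, energy]
    positivity
  le_lower := by simp [State.init]
  separated := by simp

/-- Only pairs whose later member is the new element are new in `separated`. For them the test gives
|E(a) - d(a,i)| ≤ l(i) < E^cl, and E^cl is at most the energy of everything processed so far. -/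
theorem Invariant.step {x : Fin N → X} {l : List (Fin N)} {s : State N} (h : Invariant x l s)
    {i : Fin N} (hi : i ∉ l) : Invariant x (l ++ [i]) (step x s i) := by
  unfold Trimed.step
  have hic : i ∉ s.computed := fun hc => hi (h.computed_mem i hc)
  split_ifs with hlt
  -- Overwriting l(i) by E(i) never lowers a bound, so bounds left by earlier elements survive.
  · have hmono : ∀ j, s.lower j ≤ Function.update s.lower i (energy x i) j := by
      intro j
      by_cases hj : j = i
      · subst hj; simpa using h.lower_le j
      · simp [hj]
    refine ⟨?_, ?_, ?_, ?_, ?_⟩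
    · intro k hk
      rcases Finset.mem_insert.1 hk with rfl | hk
      · simp
      · simp [h.computed_mem k hk]
    · intro k hk
      change (if (energy x i : EReal) < s.bestEnergy then (energy x i : EReal) else s.bestEnergy)
        ≤ _
      rcases List.mem_append.1 hk with hk | hk
      · split_ifs with h1
        · exact h1.le.trans (h.bestEnergy_le k hk)
        · exact h.bestEnergy_le k hk
      · rw [List.mem_singleton.1 hk]
        split_ifs with h1
        · exact le_rfl
        · exact not_lt.1 h1
    · intro j
      refine max_le ?_ (abs_energy_sub_dist_le x i j)
      change Function.update s.lower i (energy x i) j ≤ _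
      by_cases hj : j = i
      · subst hj; simp
      · simpa [hj] using h.lower_le j
    · intro k hk j
      rcases Finset.mem_insert.1 hk with rfl | hk
      · exact le_max_right _ _
      · exact (h.le_lower k hk j).trans ((hmono j).trans (le_max_left _ _))
    · intro l₁ b l₂ hl hb a ha hac c hc
      rcases List.eq_nil_or_concat l₂ with rfl | ⟨l₃, e, rfl⟩
      · obtain ⟨rfl, hib⟩ := List.append_inj' hl rfl
        obtain rfl : i = b := by simpa using hib
        have hac' : a ∈ s.computed := by
          rcases Finset.mem_insert.1 hac with rfl | h1
          · exact absurd ha hi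
          · exact h1
        have h1 := h.le_lower a hac' i
        have h2 := hlt.trans_le (h.bestEnergy_le c hc)
        exact h1.trans_lt (by exact_mod_cast h2)
      · have hl' : l ++ [i] = (l₁ ++ b :: l₃) ++ [e] := by simpa using hl
        obtain ⟨rfl, -⟩ := List.append_inj' hl' rfl
        have mem : ∀ k ∈ l₁ ++ b :: l₃, k ∈ insert i s.computed → k ∈ s.computed := by
          intro k hk hk'
          rcases Finset.mem_insert.1 hk' with rfl | h1
          · exact absurd hk hi
          · exact h1
        exact h.separated l₁ b l₃ rfl (mem b (by simp) hb) a ha (mem a (by simp [ha]) hac) c hc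
  · refine ⟨?_, ?_, h.lower_le, h.le_lower, ?_⟩
    · intro k hk
      simp [h.computed_mem k hk]
    · intro k hk
      rcases List.mem_append.1 hk with hk | hk
      · exact h.bestEnergy_le k hk
      · rw [List.mem_singleton.1 hk]
        -- An eliminated element also has energy at least E^cl, since E^cl ≤ l(i) ≤ E(i).
        exact (not_lt.1 hlt).trans (by exact_mod_cast h.lower_le i)
    · intro l₁ b l₂ hl hb a ha hac c hc
      rcases List.eq_nil_or_concat l₂ with rfl | ⟨l₃, e, rfl⟩
      · obtain ⟨rfl, hib⟩ := List.append_inj' hl rfl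
        obtain rfl : i = b := by simpa using hib
        exact absurd hb hic
      · have hl' : l ++ [i] = (l₁ ++ b :: l₃) ++ [e] := by simpa using hl
        obtain ⟨rfl, -⟩ := List.append_inj' hl' rfl
        exact h.separated l₁ b l₃ rfl hb a ha hac c hc

theorem invariant_foldl (x : Fin N → X) (l : List (Fin N)) (hl : l.Nodup) :
    Invariant x l (l.foldl (step x) (State.init N)) := by
  induction l using List.reverseRecOn with
  | nil => exact Invariant.init x
  | append_singleton l i ih =>
    rw [List.foldl_append]
    have := List.nodup_append.1 hl
    refine (ih this.1).step fun hi => ?_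
    exact this.2.2 i hi i (by simp) rfl

theorem energy_comp_perm (x : Fin N → X) (σ : Equiv.Perm (Fin N)) (k : Fin N) :
    energy (x ∘ σ) k = energy x (σ k) := by
  unfold energy
  congr 1
  exact Equiv.sum_comp σ fun j => dist (x (σ k)) (x j)

/-- The positions in the processing order of the computed elements. -/
theorem exists_computed_positions (x : Fin N → X) (σ : Equiv.Perm (Fin N)) :
    ∃ S : Finset (Fin N), S.card = numComputed x σ ∧
      ∀ a ∈ S, ∀ b ∈ S, a < b → ∀ c < b,
        energy (x ∘ σ) a - dist ((x ∘ σ) a) ((x ∘ σ) b) < energy (x ∘ σ) c := by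
  have inv := invariant_foldl x (List.ofFn fun k => σ k) (List.nodup_ofFn.2 σ.injective)
  refine ⟨(run x σ).computed.map σ.symm.toEmbedding, by simp [numComputed], ?_⟩
  intro a ha b hb hab c hcb
  have ha' : σ a ∈ (run x σ).computed := by
    simpa [Finset.mem_map_equiv] using ha
  have hb' : σ b ∈ (run x σ).computed := by
    simpa [Finset.mem_map_equiv] using hb
  have hlen : (b : ℕ) < (List.ofFn fun k => σ k).length := by simp
  have hsplit : (List.ofFn fun k => σ k) = (List.ofFn fun k => σ k).take b ++
      σ b :: (List.ofFn fun k => σ k).drop (b + 1) := by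
    conv_lhs => rw [← List.take_append_drop b (List.ofFn fun k => σ k),
      List.drop_eq_getElem_cons hlen]
    simp
  have mem : ∀ k < b, σ k ∈ (List.ofFn fun k => σ k).take b := by
    intro k hk
    rw [List.mem_take_iff_getElem]
    exact ⟨k, by simp [hk], by simp⟩
  have := inv.separated _ _ _ hsplit hb' (σ a) (mem a hab) ha' (σ c) (mem c hcb)
  rw [energy_comp_perm, energy_comp_perm]
  exact (le_abs_self _).trans_lt this

end Algorithm

/-! ### Packing bounds for separated points -/

section Packing

theorem separated_of_lt {X ι : Type*} [PseudoMetricSpace X] [LinearOrder ι] {T : Finset ι} {y : ι → X} {δ : ℝ}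
    (h : ∀ a ∈ T, ∀ b ∈ T, a < b → δ ≤ dist (y a) (y b)) :
    ∀ a ∈ T, ∀ b ∈ T, a ≠ b → δ ≤ dist (y a) (y b) := by
  intro a ha b hb hab
  rcases hab.lt_or_gt with h1 | h1
  · exact h a ha b hb h1
  · rw [dist_comm]; exact h b hb a ha h1

variable {E : Type*} [NormedAddCommGroup E] [NormedSpace ℝ E] [FiniteDimensional ℝ E]

/-- Packing bound: `2η`-separated points in a ball of radius `R`. -/
theorem card_mul_pow_le_of_separated {ι : Type*} (T : Finset ι) (y : ι → E) (z : E) {η R : ℝ}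
    (hη : 0 < η) (hR : 0 ≤ R) (hz : ∀ a ∈ T, dist (y a) z ≤ R)
    (hsep : ∀ a ∈ T, ∀ b ∈ T, a ≠ b → 2 * η ≤ dist (y a) (y b)) :
    (T.card : ℝ) * η ^ Module.finrank ℝ E ≤ (R + η) ^ Module.finrank ℝ E := by
  let _ : MeasurableSpace E := borel E
  have _ : BorelSpace E := ⟨rfl⟩
  let μ : Measure E := Measure.addHaar
  have hdisj : Set.PairwiseDisjoint (T : Set ι) fun a => Metric.ball (y a) η := by
    intro a ha b hb hab
    exact Metric.ball_disjoint_ball (by linarith [hsep a ha b hb hab])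
  have hsub : (⋃ a ∈ T, Metric.ball (y a) η) ⊆ Metric.ball z (R + η) := by
    refine Set.iUnion₂_subset fun a ha => Metric.ball_subset_ball' ?_
    linarith [hz a ha]
  have h1 : ∑ a ∈ T, μ (Metric.ball (y a) η) ≤ μ (Metric.ball z (R + η)) := by
    rw [← measure_biUnion_finset hdisj fun a _ => measurableSet_ball]
    exact measure_mono hsub
  simp only [Measure.addHaar_ball_of_pos μ _ hη, Measure.addHaar_ball_of_pos μ z
    (show 0 < R + η by linarith), Finset.sum_const, nsmul_eq_mul] at h1
  rw [← mul_assoc] at h1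
  have h2 := (ENNReal.mul_le_mul_iff_left (Metric.measure_ball_pos μ 0 one_pos).ne'
    measure_ball_lt_top.ne).1 h1
  rw [← ENNReal.ofReal_natCast, ← ENNReal.ofReal_mul (by positivity)] at h2
  exact (ENNReal.ofReal_le_ofReal_iff (by positivity)).1 h2

/-- The number of points in the shells `r q ^ k ≤ dist ≤ r q ^ (k + 1)`, `k < K`, from bounds for
the single shells. -/
theorem card_le_sum_shells {ι : Type*} (T : Finset ι) (e : ι → ℝ) {r q : ℝ} (K : ℕ)
    (c : ℕ → ℝ) (hr : 0 < r) (hq : 1 < q) (hlo : ∀ a ∈ T, r ≤ e a) (hhi : ∀ a ∈ T, e a < r * q ^ K)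
    (hc : ∀ k < K, ∀ T' ⊆ T, (∀ a ∈ T', r * q ^ k ≤ e a ∧ e a ≤ r * q ^ (k + 1)) →
      (T'.card : ℝ) ≤ c k) :
    (T.card : ℝ) ≤ ∑ k ∈ Finset.range K, c k := by
  classical
  have hex : ∀ a ∈ T, ∃ k ∈ Finset.range K, r * q ^ k ≤ e a ∧ e a ≤ r * q ^ (k + 1) := by
    intro a ha
    obtain ⟨k, hk1, hk2⟩ := exists_nat_pow_near (x := e a / r) (y := q)
      ((one_le_div hr).2 (hlo a ha)) hq
    rw [le_div_iff₀ hr, mul_comm] at hk1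
    rw [div_lt_iff₀ hr, mul_comm] at hk2
    refine ⟨k, Finset.mem_range.2 ?_, hk1, hk2.le⟩
    have := hk1.trans_lt (hhi a ha)
    exact (pow_lt_pow_iff_right₀ hq).1 (lt_of_mul_lt_mul_left this hr.le)
  have hsub : T ⊆ (Finset.range K).biUnion fun k =>
      T.filter fun a => r * q ^ k ≤ e a ∧ e a ≤ r * q ^ (k + 1) := by
    intro a ha
    obtain ⟨k, hk, h⟩ := hex a ha
    exact Finset.mem_biUnion.2 ⟨k, hk, Finset.mem_filter.2 ⟨ha, h⟩⟩
  have h1 := (Finset.card_le_card hsub).trans Finset.card_biUnion_le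
  calc (T.card : ℝ) ≤ ∑ k ∈ Finset.range K,
        ((T.filter fun a => r * q ^ k ≤ e a ∧ e a ≤ r * q ^ (k + 1)).card : ℝ) := by
        exact_mod_cast h1
    _ ≤ _ := Finset.sum_le_sum fun k hk => hc k (Finset.mem_range.1 hk) _
        (Finset.filter_subset _ _) fun a ha => (Finset.mem_filter.1 ha).2

variable {ι : Type*} [LinearOrder ι]

/-- Separation and radius both scale with the distance, so every dyadic shell admits the same
packing bound. -/
theorem card_le_of_linear_separation (T : Finset ι) (y : ι → E) (z : E) {r κ : ℝ} (K : ℕ)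
    (hr : 0 < r) (hκ : 0 < κ) (hlo : ∀ a ∈ T, r ≤ dist (y a) z)
    (hhi : ∀ a ∈ T, dist (y a) z < r * 2 ^ K)
    (hsep : ∀ a ∈ T, ∀ b ∈ T, a < b → κ * dist (y a) z ≤ dist (y a) (y b)) :
    (T.card : ℝ) ≤ K * (4 / κ + 1) ^ Module.finrank ℝ E := by
  have := card_le_sum_shells T (fun a => dist (y a) z) K
    (fun _ => (4 / κ + 1) ^ Module.finrank ℝ E) hr one_lt_two hlo hhi ?_
  · simpa using this
  intro k _ T' hT' hk
  have hη : 0 < κ * (r * 2 ^ k) / 2 := by positivity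
  have h1 := card_mul_pow_le_of_separated T' y z (R := r * 2 ^ (k + 1)) hη (by positivity)
    (fun a ha => (hk a ha).2) (separated_of_lt fun a ha b hb hab => ?_)
  · rw [← le_div_iff₀ (by positivity), ← div_pow] at h1
    refine h1.trans_eq ?_
    congr 1
    field_simp
    ring
  · have h2 := hsep a (hT' ha) b (hT' hb) hab
    have h3 := mul_le_mul_of_nonneg_left (hk a ha).1 hκ.le
    linarith

/-- A shell of radius s holds at most 8 (4/(αs))^d points, and the shells sum geometrically. Shells
of ratio 1 + 1/d, rather than 2, keep the prefactor free of any further exponential dependence on d.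
-/
theorem card_le_of_quadratic_separation (T : Finset ι) (y : ι → E) (z : E) {r R α : ℝ}
    (hd : 1 ≤ Module.finrank ℝ E) (hr : 0 < r) (hα : 0 < α)
    (hR : α * R * Module.finrank ℝ E ≤ 4)
    (hlo : ∀ a ∈ T, r ≤ dist (y a) z) (hhi : ∀ a ∈ T, dist (y a) z ≤ R)
    (hsep : ∀ a ∈ T, ∀ b ∈ T, a < b → α * dist (y a) z ^ 2 / 2 ≤ dist (y a) (y b)) :
    (T.card : ℝ) ≤ 16 * (4 / α) ^ Module.finrank ℝ E / r ^ Module.finrank ℝ E := by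
  set d := Module.finrank ℝ E
  have hd0 : (0 : ℝ) < d := by exact_mod_cast hd
  set q : ℝ := 1 + 1 / d with hq_def
  have hq : 1 < q := by
    have : 0 < 1 / (d : ℝ) := by positivity
    linarith
  have hq0 : 0 < q := by linarith
  obtain ⟨K, hK⟩ := pow_unbounded_of_one_lt (R / r) hq
  rw [div_lt_iff₀ hr, mul_comm] at hK
  -- Bernoulli: the shell bounds at least halve from one shell to the next.
  have hq2 : (2 : ℝ) ≤ q ^ d := by
    have := one_add_mul_le_pow (a := 1 / (d : ℝ)) (by have : 0 < 1 / (d : ℝ) := by positivity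
                                                      linarith) d
    rw [mul_one_div_cancel hd0.ne'] at this
    linarith
  -- At most e², which is below 8.
  have he : (1 + 2 / (d : ℝ)) ^ d ≤ 8 := by
    have h1 : (1 + 2 / (d : ℝ)) ^ d ≤ Real.exp (2 / d) ^ d :=
      pow_le_pow_left₀ (by positivity) (by linarith [Real.add_one_le_exp (2 / (d : ℝ))]) d
    rw [← Real.exp_nat_mul, mul_div_cancel₀ _ hd0.ne'] at h1
    have h2 : Real.exp 2 = Real.exp 1 * Real.exp 1 := by rw [← Real.exp_add]; norm_num
    have h3 := Real.exp_one_lt_d9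
    have h4 := Real.exp_pos 1
    nlinarith
  have := card_le_sum_shells T (fun a => dist (y a) z) K
    (fun k => 8 * (4 / α) ^ d / r ^ d * (1 / 2) ^ k) hr hq hlo
    (fun a ha => (hhi a ha).trans_lt hK) ?_
  · refine this.trans ?_
    rw [← Finset.mul_sum]
    have h2 : ∑ k ∈ Finset.range K, (1 / 2 : ℝ) ^ k ≤ 2 := sum_geometric_two_le K
    calc 8 * (4 / α) ^ d / r ^ d * ∑ k ∈ Finset.range K, (1 / 2 : ℝ) ^ k
        ≤ 8 * (4 / α) ^ d / r ^ d * 2 := mul_le_mul_of_nonneg_left h2 (by positivity)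
      _ = _ := by ring
  intro k _ T' hT' hk
  rcases T'.eq_empty_or_nonempty with rfl | ⟨a₀, ha₀⟩
  · simp only [Finset.card_empty, Nat.cast_zero]; positivity
  set s := r * q ^ k with hs
  have hs0 : 0 < s := by positivity
  have hsR : s ≤ R := (hk a₀ ha₀).1.trans (hhi a₀ (hT' ha₀))
  have hη : 0 < α * s ^ 2 / 4 := by positivity
  have h1 := card_mul_pow_le_of_separated T' y z (R := s * q) hη (by positivity)
    (fun a ha => (hk a ha).2.trans_eq (by rw [hs]; ring)) (separated_of_lt fun a ha b hb hab => ?_)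
  -- The condition α R d ≤ 4 makes the packing radius α s²/4 at most s/d, so the enlarged ball has
  -- radius at most (1 + 2/d) s.
  · have h3 : s * q + α * s ^ 2 / 4 ≤ (1 + 2 / d) * s := by
      have : α * s * d ≤ 4 := le_trans (by gcongr) hR
      have h4 : α * s / 4 ≤ 1 / d := by rw [div_le_div_iff₀ (by norm_num) hd0]; linarith
      have h5 := mul_le_mul_of_nonneg_right h4 hs0.le
      rw [hq_def]
      calc _ = s + 1 / d * s + α * s / 4 * s := by ring
        _ ≤ s + 1 / d * s + 1 / d * s := by linarith
        _ = _ := by ring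
    have h4 : (T'.card : ℝ) * (α * s ^ 2 / 4) ^ d ≤ 8 * s ^ d := by
      refine h1.trans ((pow_le_pow_left₀ (by positivity) h3 d).trans ?_)
      rw [mul_pow]
      gcongr
    have h5 : (T'.card : ℝ) ≤ 8 * (4 / α) ^ d / s ^ d := by
      rw [← le_div_iff₀ (by positivity)] at h4
      refine h4.trans_eq ?_
      rw [mul_div_assoc, mul_div_assoc 8, ← div_pow, ← div_pow]
      congr 2
      field_simp
    refine h5.trans ?_
    rw [hs, mul_pow, ← div_div, div_eq_mul_one_div _ ((q ^ k) ^ d)]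
    refine mul_le_mul_of_nonneg_left ?_ (by positivity)
    rw [← pow_mul, mul_comm k d, pow_mul, one_div_pow]
    exact one_div_le_one_div_of_le (by positivity) (pow_le_pow_left₀ (by norm_num) hq2 k)
  · have h2 := hsep a (hT' ha) b (hT' hb) hab
    have h3 := pow_le_pow_left₀ hs0.le (hk a ha).1 2
    have h4 := mul_le_mul_of_nonneg_left h3 hα.le
    linarith

end Packing

/-! ### Linear growth of the energy far from the medoid -/

section Energy

variable {E : Type*} [NormedAddCommGroup E] {N : ℕ}

/-- A point k with ‖y k‖ ≤ M contributes at least ‖y i‖ - ‖y j‖ - 2M. Any other point loses at most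
a further 2‖y i‖, and a quarter of such points cost ‖y i‖/2 on average. -/
theorem le_energy_sub_energy (y : Fin N → E) {M : ℝ} (hM : 0 ≤ M)
    (h : (((Finset.univ.filter fun k => M < ‖y k‖).card : ℕ) : ℝ) ≤ N / 4) (i j : Fin N) :
    ‖y i‖ / 2 - ‖y j‖ - 2 * M ≤ energy y i - energy y j := by
  have hN : (0 : ℝ) < N := by exact_mod_cast i.pos
  set B := Finset.univ.filter fun k => M < ‖y k‖ with hB
  have hterm : ∀ k, (‖y i‖ - ‖y j‖ - 2 * M) - (if k ∈ B then 2 * ‖y i‖ else 0) ≤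
      dist (y i) (y k) - dist (y j) (y k) := by
    intro k
    have h1 : ‖y i‖ ≤ dist (y i) (y k) + ‖y k‖ := by
      rw [dist_eq_norm]
      have := norm_add_le (y i - y k) (y k)
      simpa using this
    have h2 : dist (y j) (y k) ≤ ‖y j‖ + ‖y k‖ := dist_le_norm_add_norm _ _
    have h3 : dist (y j) (y k) ≤ dist (y j) (y i) + dist (y i) (y k) := dist_triangle _ _ _
    have h4 : dist (y j) (y i) ≤ ‖y j‖ + ‖y i‖ := dist_le_norm_add_norm _ _
    split_ifs with hk
    · linarith
    · have : ‖y k‖ ≤ M := by simpa [hB] using hk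
      linarith
  have hsum := Finset.sum_le_sum fun k (_ : k ∈ Finset.univ) => hterm k
  rw [Finset.sum_sub_distrib, Finset.sum_sub_distrib (fun k => dist (y i) (y k))] at hsum
  simp only [Finset.sum_const, Finset.card_univ, Fintype.card_fin, nsmul_eq_mul,
    Finset.sum_ite_mem, Finset.univ_inter] at hsum
  have hb : (B.card : ℝ) * (2 * ‖y i‖) ≤ N / 4 * (2 * ‖y i‖) :=
    mul_le_mul_of_nonneg_right h (by positivity)
  unfold energy
  rw [← mul_sub, one_div, inv_mul_eq_div, le_div_iff₀ hN]
  refine le_trans ?_ hsum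
  linarith

theorem IsMedoid.norm_le {y : Fin N → E} {m : Fin N} (hm : IsMedoid y m) {M : ℝ} (hM : 0 ≤ M)
    (h : (((Finset.univ.filter fun k => M < ‖y k‖).card : ℕ) : ℝ) ≤ N / 4) : ‖y m‖ ≤ 6 * M := by
  have hN : (0 : ℝ) < N := by exact_mod_cast m.pos
  obtain ⟨j, hj⟩ : ∃ j, ‖y j‖ ≤ M := by
    by_contra! hcon
    have : (Finset.univ.filter fun k => M < ‖y k‖) = Finset.univ := by
      ext k; simp [hcon k]
    rw [this, Finset.card_univ, Fintype.card_fin] at h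
    linarith
  have h1 := le_energy_sub_energy y hM h m j
  have h3 := hm j
  linarith

/-- Since ‖y m‖ ≤ 6M, the excess is at least (dist - 6M)/2 - 6M - 2M = dist/2 - 11M; the threshold
44M is where this reaches dist/4. -/
theorem IsMedoid.quarter_dist_le {y : Fin N → E} {m : Fin N} (hm : IsMedoid y m) {M : ℝ}
    (hM : 0 ≤ M) (h : (((Finset.univ.filter fun k => M < ‖y k‖).card : ℕ) : ℝ) ≤ N / 4)
    (i : Fin N) (hi : 44 * M ≤ dist (y i) (y m)) :
    dist (y i) (y m) / 4 ≤ energy y i - energy y m := by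
  have h1 := hm.norm_le hM h
  have h2 := le_energy_sub_energy y hM h i m
  have h4 : dist (y i) (y m) ≤ ‖y i‖ + ‖y m‖ := dist_le_norm_add_norm _ _
  linarith

end Energy

/-! ### Tail bounds around a sample-dependent centre -/

section Independence

variable {E : Type*} [MeasurableSpace E] {N : ℕ}

/-- Fubini: with the coordinate m fixed in G, the remaining factors are independent, each of mean at
most c. -/
theorem lintegral_indicator_mul_prod_le (μ : Measure E) [IsProbabilityMeasure μ] (m : Fin N)
    (I : Finset (Fin N)) (hm : m ∉ I) {G : Set E} (hG : MeasurableSet G) {g : E × E → ℝ≥0∞}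
    (hg : Measurable g) {c : ℝ≥0∞} (hc : ∀ z ∈ G, ∫⁻ w, g (z, w) ∂μ ≤ c) :
    ∫⁻ y, G.indicator 1 (y m) * ∏ k ∈ I, g (y m, y k) ∂(Measure.pi fun _ : Fin N => μ)
      ≤ c ^ I.card := by
  obtain ⟨n, rfl⟩ : ∃ n, N = n + 1 := ⟨N - 1, by have := m.pos; omega⟩
  obtain ⟨J, rfl⟩ : ∃ J : Finset (Fin n), I = J.map m.succAboveEmb := by
    refine ⟨Finset.univ.filter fun j => m.succAbove j ∈ I, ?_⟩
    ext k
    simp only [Finset.mem_map, Finset.mem_filter, Finset.mem_univ, true_and, Fin.coe_succAboveEmb]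
    constructor
    · intro hk
      obtain ⟨j, rfl⟩ := Fin.exists_succAbove_eq (show k ≠ m by rintro rfl; exact hm hk)
      exact ⟨j, hk, rfl⟩
    · rintro ⟨j, hj, rfl⟩
      exact hj
  let H : E × (Fin n → E) → ℝ≥0∞ := fun p => G.indicator 1 p.1 * ∏ j ∈ J, g (p.1, p.2 j)
  have hH : Measurable H := by
    refine ((measurable_one.indicator hG).comp measurable_fst).mul ?_
    refine Finset.measurable_fun_prod _ fun j _ => hg.comp ?_
    exact measurable_fst.prodMk ((measurable_pi_apply j).comp measurable_snd)
  have hmp := measurePreserving_piFinSuccAbove (fun _ : Fin (n + 1) => μ) m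
  have h1 : ∫⁻ y, G.indicator 1 (y m) * ∏ k ∈ J.map m.succAboveEmb, g (y m, y k)
      ∂(Measure.pi fun _ : Fin (n + 1) => μ) =
      ∫⁻ y, H (MeasurableEquiv.piFinSuccAbove (fun _ => E) m y)
        ∂(Measure.pi fun _ : Fin (n + 1) => μ) := by
    refine lintegral_congr fun y => ?_
    simp only [H, Finset.prod_map]
    rfl
  rw [h1, hmp.lintegral_comp hH, lintegral_prod _ hH.aemeasurable]
  have h2 : ∀ z, ∫⁻ w, H (z, w) ∂(Measure.pi fun _ : Fin n => μ) ≤ c ^ J.card := by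
    intro z
    by_cases hz : z ∈ G
    · have hgz : Measurable fun w => g (z, w) := hg.comp measurable_prodMk_left
      have hind := ProbabilityTheory.iIndepFun_pi (ι := Fin n) (μ := fun _ => μ)
        (X := fun _ w => g (z, w)) fun _ => hgz.aemeasurable
      simp only [H, Set.indicator_of_mem hz, Pi.one_apply, one_mul]
      rw [ProbabilityTheory.lintegral_prod_eq_prod_lintegral_of_indepFun J
        (fun j (w : Fin n → E) => g (z, w j)) hind fun j => hgz.comp (measurable_pi_apply j)]
      refine (Finset.prod_le_pow_card _ _ c fun j _ => ?_)
      rw [(measurePreserving_eval (fun _ : Fin n => μ) j).lintegral_comp hgz]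
      exact hc z hz
    · simp [H, Set.indicator_of_notMem hz]
  rw [Finset.card_map]
  refine (lintegral_mono h2).trans ?_
  simp

open Classical in
/-- If `A z` has probability at most `p`, then for the other points with indices in `I` it is
exponentially unlikely that `h` of them lie in `A (y m)`. -/
theorem measure_many_le (μ : Measure E) [IsProbabilityMeasure μ] {A : Set (E × E)}
    (hA : MeasurableSet A) {p h : ℝ} (hp : 0 ≤ p) (I : Finset (Fin N)) :
    (Measure.pi fun _ : Fin N => μ) {y | ∃ m, μ (Prod.mk (y m) ⁻¹' A) ≤ ENNReal.ofReal p ∧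
      h ≤ ((I.erase m).filter fun k => (y m, y k) ∈ A).card} ≤
    ENNReal.ofReal (N * Real.exp (2 * p * I.card - h)) := by
  have hset : {y : Fin N → E | ∃ m, μ (Prod.mk (y m) ⁻¹' A) ≤ ENNReal.ofReal p ∧
      h ≤ ((I.erase m).filter fun k => (y m, y k) ∈ A).card} =
      ⋃ m ∈ (Finset.univ : Finset (Fin N)), {y | μ (Prod.mk (y m) ⁻¹' A) ≤ ENNReal.ofReal p ∧
        h ≤ ((I.erase m).filter fun k => (y m, y k) ∈ A).card} := by
    ext y; simp
  rw [hset]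
  refine (measure_biUnion_finset_le _ _).trans ?_
  have key : ∀ m : Fin N, (Measure.pi fun _ : Fin N => μ)
      {y | μ (Prod.mk (y m) ⁻¹' A) ≤ ENNReal.ofReal p ∧
        h ≤ ((I.erase m).filter fun k => (y m, y k) ∈ A).card} ≤
      ENNReal.ofReal (Real.exp (2 * p * I.card - h)) := by
    intro m
    let G : Set E := {z | μ (Prod.mk z ⁻¹' A) ≤ ENNReal.ofReal p}
    have hG : MeasurableSet G := measurable_measure_prodMk_left hA measurableSet_Iic
    -- This is the exponential of the indicator of A, for a Chernoff bound: its mean is at most 1 +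
    -- 2p ≤ exp(2p).
    let g : E × E → ℝ≥0∞ := fun q => 1 + A.indicator (fun _ => ENNReal.ofReal (Real.exp 1 - 1)) q
    have hg : Measurable g := by
      have : Measurable (A.indicator fun _ => ENNReal.ofReal (Real.exp 1 - 1)) :=
        measurable_const.indicator hA
      exact this.const_add 1
    have he2 : Real.exp 1 - 1 ≤ 2 := by have := Real.exp_one_lt_d9; linarith
    have he0 : 0 ≤ Real.exp 1 - 1 := by have := Real.add_one_le_exp 1; linarith
    have hc : ∀ z ∈ G, ∫⁻ w, g (z, w) ∂μ ≤ ENNReal.ofReal (Real.exp (2 * p)) := by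
      intro z hz
      have hAz : MeasurableSet (Prod.mk z ⁻¹' A) := measurable_prodMk_left hA
      have : ∀ w, g (z, w) = 1 + (Prod.mk z ⁻¹' A).indicator
          (fun _ => ENNReal.ofReal (Real.exp 1 - 1)) w := fun w => rfl
      simp_rw [this]
      rw [lintegral_add_left measurable_const, lintegral_indicator_const hAz, lintegral_const,
        measure_univ, mul_one]
      calc 1 + ENNReal.ofReal (Real.exp 1 - 1) * μ (Prod.mk z ⁻¹' A)
          ≤ ENNReal.ofReal 1 + ENNReal.ofReal 2 * ENNReal.ofReal p := by
            rw [ENNReal.ofReal_one]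
            exact add_le_add le_rfl (mul_le_mul' (ENNReal.ofReal_le_ofReal he2) hz)
        _ = ENNReal.ofReal (2 * p + 1) := by
            rw [← ENNReal.ofReal_mul (by norm_num), ← ENNReal.ofReal_add (by norm_num)
              (by positivity), add_comm]
        _ ≤ _ := ENNReal.ofReal_le_ofReal (Real.add_one_le_exp _)
    have h1 := lintegral_indicator_mul_prod_le μ m (I.erase m) (Finset.notMem_erase m I) hG hg hc
    have h2 := mul_meas_ge_le_lintegral₀ (μ := Measure.pi fun _ : Fin N => μ)
      (f := fun y => G.indicator 1 (y m) * ∏ k ∈ I.erase m, g (y m, y k)) (by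
        refine Measurable.aemeasurable ?_
        refine ((measurable_one.indicator hG).comp (measurable_pi_apply m)).mul ?_
        refine Finset.measurable_fun_prod _ fun j _ => hg.comp ?_
        exact (measurable_pi_apply m).prodMk (measurable_pi_apply j))
      (ENNReal.ofReal (Real.exp h))
    have h3 : {y : Fin N → E | μ (Prod.mk (y m) ⁻¹' A) ≤ ENNReal.ofReal p ∧
        h ≤ ((I.erase m).filter fun k => (y m, y k) ∈ A).card} ⊆
        {y | ENNReal.ofReal (Real.exp h) ≤
          G.indicator 1 (y m) * ∏ k ∈ I.erase m, g (y m, y k)} := by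
      rintro y ⟨hy1, hy2⟩
      have hyG : y m ∈ G := hy1
      simp only [Set.mem_ofPred_eq, Set.indicator_of_mem hyG, Pi.one_apply, one_mul]
      have hgA : ∀ q ∈ A, g q = ENNReal.ofReal (Real.exp 1) := by
        intro q hq
        simp only [g, Set.indicator_of_mem hq]
        rw [← ENNReal.ofReal_one, ← ENNReal.ofReal_add zero_le_one he0]
        congr 1; ring
      calc ENNReal.ofReal (Real.exp h)
          ≤ ENNReal.ofReal (Real.exp 1) ^ ((I.erase m).filter fun k => (y m, y k) ∈ A).card := by
            rw [← ENNReal.ofReal_pow (Real.exp_pos _).le, ← Real.exp_nat_mul, mul_one]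
            exact ENNReal.ofReal_le_ofReal (Real.exp_le_exp.2 hy2)
        _ = ∏ k ∈ (I.erase m).filter fun k => (y m, y k) ∈ A, g (y m, y k) := by
            rw [Finset.prod_congr rfl fun k hk => hgA _ (Finset.mem_filter.1 hk).2,
              Finset.prod_const]
        _ ≤ ∏ k ∈ I.erase m, g (y m, y k) :=
            Finset.prod_le_prod_of_subset_of_one_le' (Finset.filter_subset _ _)
              fun k _ _ => le_self_add
    have h4 : ENNReal.ofReal (Real.exp (2 * p)) ^ (I.erase m).card ≤
        ENNReal.ofReal (Real.exp (2 * p * I.card)) := by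
      rw [← ENNReal.ofReal_pow (Real.exp_pos _).le, ← Real.exp_nat_mul]
      refine ENNReal.ofReal_le_ofReal (Real.exp_le_exp.2 ?_)
      rw [mul_comm]
      refine mul_le_mul_of_nonneg_left ?_ (by positivity)
      exact_mod_cast Finset.card_le_card (Finset.erase_subset m I)
    have h5 := (mul_le_mul_right (measure_mono h3) _).trans (h2.trans (h1.trans h4))
    rw [Real.exp_sub, ENNReal.ofReal_div_of_pos (Real.exp_pos _)]
    rw [ENNReal.le_div_iff_mul_le (Or.inl (by simp [Real.exp_pos])) (Or.inl ENNReal.ofReal_ne_top),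
      mul_comm]
    exact h5
  refine (Finset.sum_le_sum fun m _ => key m).trans_eq ?_
  rw [Finset.sum_const, Finset.card_univ, Fintype.card_fin, nsmul_eq_mul,
    ENNReal.ofReal_mul (by positivity), ENNReal.ofReal_natCast]

/-- If `A z` has probability at most `p`, then it is exponentially unlikely that more than `h + 1`
of the points with indices in `I` lie in `A (y m)`. -/
theorem measure_exists_card_le (μ : Measure E) [IsProbabilityMeasure μ] {A : Set (E × E)}
    (hA : MeasurableSet A) {p h : ℝ} (hp : 0 ≤ p) (I : Finset (Fin N)) :
    (Measure.pi fun _ : Fin N => μ) {y | ∃ m, μ (Prod.mk (y m) ⁻¹' A) ≤ ENNReal.ofReal p ∧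
      ∃ U ⊆ I, (∀ k ∈ U, (y m, y k) ∈ A) ∧ h + 1 < U.card} ≤
    ENNReal.ofReal (N * Real.exp (2 * p * I.card - h)) := by
  classical
  refine (measure_mono ?_).trans (measure_many_le μ hA hp I)
  rintro y ⟨m, hm, U, hUI, hU, hcard⟩
  refine ⟨m, hm, ?_⟩
  -- The centre m may itself belong to U, which accounts for the 1 in h + 1.
  have h1 := Finset.pred_card_le_card_erase (s := U) (a := m)
  have h2 : U.erase m ⊆ (I.erase m).filter fun k => (y m, y k) ∈ A := by
    intro k hk
    have hk' := Finset.mem_erase.1 hk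
    exact Finset.mem_filter.2 ⟨Finset.mem_erase.2 ⟨hk'.1, hUI hk'.2⟩, hU k hk'.2⟩
  have h3 := Finset.card_le_card h2
  have h4 : (U.card : ℝ) ≤ ((I.erase m).filter fun k => (y m, y k) ∈ A).card + 1 := by
    exact_mod_cast (by omega :
      U.card ≤ ((I.erase m).filter fun k => (y m, y k) ∈ A).card + 1)
  linarith

/-- If `A z` has probability at least `p`, then it is exponentially unlikely that no other point
with index in `I` lies in `A (y m)`. -/
theorem measure_none_le (μ : Measure E) [IsProbabilityMeasure μ] {A : Set (E × E)}
    (hA : MeasurableSet A) {p : ℝ} (hp : 0 ≤ p) (I : Finset (Fin N)) :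
    (Measure.pi fun _ : Fin N => μ) {y | ∃ m, ENNReal.ofReal p ≤ μ (Prod.mk (y m) ⁻¹' A) ∧
      ∀ k ∈ I.erase m, (y m, y k) ∉ A} ≤
    ENNReal.ofReal (N * Real.exp (p - p * I.card)) := by
  have hset : {y : Fin N → E | ∃ m, ENNReal.ofReal p ≤ μ (Prod.mk (y m) ⁻¹' A) ∧
      ∀ k ∈ I.erase m, (y m, y k) ∉ A} =
      ⋃ m ∈ (Finset.univ : Finset (Fin N)), {y | ENNReal.ofReal p ≤ μ (Prod.mk (y m) ⁻¹' A) ∧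
      ∀ k ∈ I.erase m, (y m, y k) ∉ A} := by
    ext y; simp
  rw [hset]
  refine (measure_biUnion_finset_le _ _).trans ?_
  have key : ∀ m : Fin N, (Measure.pi fun _ : Fin N => μ)
      {y | ENNReal.ofReal p ≤ μ (Prod.mk (y m) ⁻¹' A) ∧ ∀ k ∈ I.erase m, (y m, y k) ∉ A} ≤
      ENNReal.ofReal (Real.exp (p - p * I.card)) := by
    intro m
    let G : Set E := {z | ENNReal.ofReal p ≤ μ (Prod.mk z ⁻¹' A)}
    have hG : MeasurableSet G := measurable_measure_prodMk_left hA measurableSet_Ici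
    let g : E × E → ℝ≥0∞ := Aᶜ.indicator 1
    have hg : Measurable g := measurable_one.indicator hA.compl
    have hc : ∀ z ∈ G, ∫⁻ w, g (z, w) ∂μ ≤ ENNReal.ofReal (Real.exp (-p)) := by
      intro z hz
      have hAz : MeasurableSet (Prod.mk z ⁻¹' A) := measurable_prodMk_left hA
      have : ∀ w, g (z, w) = (Prod.mk z ⁻¹' A)ᶜ.indicator 1 w := fun w => rfl
      simp_rw [this]
      rw [lintegral_indicator_one hAz.compl, prob_compl_eq_one_sub hAz]
      calc 1 - μ (Prod.mk z ⁻¹' A) ≤ ENNReal.ofReal 1 - ENNReal.ofReal p := by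
            rw [ENNReal.ofReal_one]; exact tsub_le_tsub_left hz _
        _ = ENNReal.ofReal (1 - p) := (ENNReal.ofReal_sub _ hp).symm
        _ ≤ _ := ENNReal.ofReal_le_ofReal (by linarith [Real.add_one_le_exp (-p)])
    have h1 := lintegral_indicator_mul_prod_le μ m (I.erase m) (Finset.notMem_erase m I) hG hg hc
    have h2 := mul_meas_ge_le_lintegral₀ (μ := Measure.pi fun _ : Fin N => μ)
      (f := fun y => G.indicator 1 (y m) * ∏ k ∈ I.erase m, g (y m, y k)) (by
        refine Measurable.aemeasurable ?_
        refine ((measurable_one.indicator hG).comp (measurable_pi_apply m)).mul ?_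
        refine Finset.measurable_fun_prod _ fun j _ => hg.comp ?_
        exact (measurable_pi_apply m).prodMk (measurable_pi_apply j)) 1
    rw [one_mul] at h2
    have h3 : {y : Fin N → E | ENNReal.ofReal p ≤ μ (Prod.mk (y m) ⁻¹' A) ∧
        ∀ k ∈ I.erase m, (y m, y k) ∉ A} ⊆
        {y | 1 ≤ G.indicator 1 (y m) * ∏ k ∈ I.erase m, g (y m, y k)} := by
      rintro y ⟨hy1, hy2⟩
      have hyG : y m ∈ G := hy1
      simp only [Set.mem_ofPred_eq, Set.indicator_of_mem hyG, Pi.one_apply, one_mul]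
      rw [Finset.prod_eq_one fun k hk => ?_]
      exact Set.indicator_of_mem (hy2 k hk) _
    refine (measure_mono h3).trans (h2.trans (h1.trans ?_))
    rw [← ENNReal.ofReal_pow (Real.exp_pos _).le, ← Real.exp_nat_mul]
    refine ENNReal.ofReal_le_ofReal (Real.exp_le_exp.2 ?_)
    -- The index m may lie in I, so only |I| - 1 independent points are guaranteed; hence the p
    -- added in the exponent.
    have : (I.card : ℝ) ≤ (I.erase m).card + 1 := by
      have := Finset.pred_card_le_card_erase (s := I) (a := m)
      exact_mod_cast (by omega : I.card ≤ (I.erase m).card + 1)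
    nlinarith
  refine (Finset.sum_le_sum fun m _ => key m).trans_eq ?_
  rw [Finset.sum_const, Finset.card_univ, Fintype.card_fin, nsmul_eq_mul,
    ENNReal.ofReal_mul (by positivity), ENNReal.ofReal_natCast]

/-- Independent identically distributed points are exchangeable. -/
theorem measurePreserving_comp_perm (μ : Measure E) [IsProbabilityMeasure μ]
    (σ : Equiv.Perm (Fin N)) :
    MeasurePreserving (fun y : Fin N → E => y ∘ σ) (Measure.pi fun _ => μ)
      (Measure.pi fun _ => μ) := by
  have := measurePreserving_piCongrLeft (α := fun _ : Fin N => E) (fun _ => μ) σ.symm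
  convert this using 1
  funext y k
  rw [MeasurableEquiv.coe_piCongrLeft]
  have := Equiv.piCongrLeft_apply_apply (fun _ : Fin N => E) σ.symm y (σ k)
  simpa using this.symm

end Independence

/-! ### Measure of balls, annuli and tails under the density -/

section Density

variable {d : ℕ} {f : EuclideanSpace ℝ (Fin d) → ℝ}

theorem isProbabilityMeasure_law (hf : ∫⁻ x, ENNReal.ofReal (f x) = 1) :
    IsProbabilityMeasure (law f) :=
  ⟨by rw [law, withDensity_apply _ MeasurableSet.univ, Measure.restrict_univ, hf]⟩

theorem unitBallVolume_pos (d : ℕ) : 0 < unitBallVolume d :=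
  div_pos (Real.rpow_pos_of_pos Real.pi_pos _) (Real.Gamma_pos_of_pos (by positivity))

theorem volume_closedBall_eq (hd : 1 ≤ d) (z : EuclideanSpace ℝ (Fin d)) {r : ℝ} (hr : 0 ≤ r) :
    volume (Metric.closedBall z r) = ENNReal.ofReal (unitBallVolume d * r ^ d) := by
  have : Nonempty (Fin d) := ⟨⟨0, hd⟩⟩
  rw [EuclideanSpace.volume_closedBall, Fintype.card_fin, ← ENNReal.ofReal_pow hr,
    ← ENNReal.ofReal_mul (by positivity), mul_comm, unitBallVolume]
  congr 3
  rw [Real.sqrt_eq_rpow, ← Real.rpow_natCast, ← Real.rpow_mul Real.pi_pos.le]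
  congr 1
  ring

theorem law_closedBall_le (hd : 1 ≤ d) {z : EuclideanSpace ℝ (Fin d)} {r ρ δ : ℝ} (hr : 0 ≤ r)
    (hrρ : r ≤ ρ) (hδ : 0 ≤ δ) (hf : ∀ y, ‖y - z‖ ≤ ρ → f y ≤ δ) :
    law f (Metric.closedBall z r) ≤ ENNReal.ofReal (δ * (unitBallVolume d * r ^ d)) := by
  rw [law, withDensity_apply _ Metric.isClosed_closedBall.measurableSet,
    ENNReal.ofReal_mul hδ, ← volume_closedBall_eq hd z hr, ← setLIntegral_const]
  refine setLIntegral_mono measurable_const fun y hy => ENNReal.ofReal_le_ofReal (hf y ?_)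
  rw [← dist_eq_norm]
  exact (Metric.mem_closedBall.1 hy).trans hrρ

theorem le_law_annulus (hd : 1 ≤ d) (hfm : Measurable f) {z : EuclideanSpace ℝ (Fin d)}
    {r s ρ δ : ℝ} (hr : 0 ≤ r) (hrs : r ≤ s) (hsρ : s ≤ ρ) (hδ : 0 ≤ δ)
    (hf : ∀ y, ‖y - z‖ ≤ ρ → δ ≤ f y) :
    ENNReal.ofReal (δ * (unitBallVolume d * (s ^ d - r ^ d))) ≤
      law f (Metric.closedBall z s \ Metric.ball z r) := by
  have : Nonempty (Fin d) := ⟨⟨0, hd⟩⟩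
  have hs : 0 ≤ s := hr.trans hrs
  have hvol : volume (Metric.closedBall z s \ Metric.ball z r) =
      ENNReal.ofReal (unitBallVolume d * (s ^ d - r ^ d)) := by
    rw [measure_sdiff (Metric.ball_subset_closedBall.trans (Metric.closedBall_subset_closedBall hrs))
      measurableSet_ball.nullMeasurableSet measure_ball_lt_top.ne,
      ← Measure.addHaar_closedBall_eq_addHaar_ball, volume_closedBall_eq hd z hs,
      volume_closedBall_eq hd z hr, ← ENNReal.ofReal_sub _
        (mul_nonneg (unitBallVolume_pos d).le (by positivity)), mul_sub]
  have hmeas : MeasurableSet (Metric.closedBall z s \ Metric.ball z r) :=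
    Metric.isClosed_closedBall.measurableSet.diff measurableSet_ball
  rw [law, withDensity_apply _ hmeas, ENNReal.ofReal_mul hδ, ← hvol, ← setLIntegral_const]
  refine setLIntegral_mono hfm.ennreal_ofReal fun y hy => ENNReal.ofReal_le_ofReal (hf y ?_)
  rw [← dist_eq_norm]
  exact (Metric.mem_closedBall.1 hy.1).trans hsρ

theorem law_norm_gt_le (hf0 : ∀ x, 0 ≤ f x)
    (hint : Integrable fun x => ‖x‖ * f x) {R : ℝ} (hR : 0 < R) :
    law f {w | R < ‖w‖} ≤ ENNReal.ofReal ((∫ x, ‖x‖ * f x) / R) := by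
  have hms : MeasurableSet {w : EuclideanSpace ℝ (Fin d) | R < ‖w‖} :=
    measurableSet_lt measurable_const measurable_norm
  rw [law, withDensity_apply _ hms, ← integral_div,
    ofReal_integral_eq_lintegral_ofReal (hint.div_const R)
      (Eventually.of_forall fun x => by have := hf0 x; positivity)]
  refine (setLIntegral_mono' hms fun x hx => ENNReal.ofReal_le_ofReal ?_).trans
    (setLIntegral_le_lintegral _ _)
  rw [le_div_iff₀ hR, mul_comm]
  exact mul_le_mul_of_nonneg_right (le_of_lt hx) (hf0 x)

end Density

/-! ### Counting the computed elements -/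

section Counting

variable {d N : ℕ} {f : EuclideanSpace ℝ (Fin d) → ℝ}

/-- The number of computed elements, on a sample with a good medoid `y m` in which the points are
spread as expected. -/
theorem card_le_of_goodAt (hd : 1 ≤ d) {y : Fin N → EuclideanSpace ℝ (Fin d)} {m : Fin N}
    {S : Finset (Fin N)}
    (hS : ∀ a ∈ S, ∀ b ∈ S, a < b → ∀ c < b, energy y a - dist (y a) (y b) < energy y c)
    (hm : IsMedoid y m) {α β ρ δ₀ δ₁ τ τ' R r₀ r₁ s₀ s₁ M κ L n₀ n₁ nL : ℝ} {t₀ t₁ K : ℕ}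
    (hgood : GoodAt f α β ρ δ₀ δ₁ τ y m) (hα : 0 < α) (hβ : 0 < β) (hR : 0 < R) (hRρ : R ≤ ρ)
    (hαR : α * R * d ≤ 4) (hτ : τ ≤ τ') (hr₀ : 0 < r₀) (hτr : τ' ≤ r₀) (hr₀₁ : r₀ ≤ r₁)
    (hr₁ : r₁ ≤ R) (hs₀ : s₀ ≤ ρ) (hs₁ : s₁ ≤ ρ) (hsr₀ : β * s₀ ^ 2 ≤ α * r₁ ^ 2 / 2)
    (hsr₁ : β * s₁ ^ 2 ≤ α * r₀ ^ 2 / 2)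
    (hc₀ : ∃ k : Fin N, (k : ℕ) < t₀ ∧ τ' ≤ dist (y k) (y m) ∧ dist (y k) (y m) ≤ s₀)
    (hc₁ : ∃ k : Fin N, (k : ℕ) < t₁ ∧ τ' ≤ dist (y k) (y m) ∧ dist (y k) (y m) ≤ s₁)
    (hM : 0 ≤ M) (hfar : (((Finset.univ.filter fun k => M < ‖y k‖).card : ℕ) : ℝ) ≤ N / 4)
    (hκ : 0 < κ) (hκ8 : κ ≤ 1 / 8) (hκM : κ * (44 * M) ≤ α * R ^ 2 / 2)
    (hK : L + 6 * M < R * 2 ^ K)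
    (hn₀ : ∀ U : Finset (Fin N), (∀ k ∈ U, dist (y k) (y m) ≤ r₀) → (U.card : ℝ) ≤ n₀)
    (hn₁ : ∀ U : Finset (Fin N), (∀ k ∈ U, (k : ℕ) < t₁ ∧ dist (y k) (y m) ≤ r₁) →
      (U.card : ℝ) ≤ n₁)
    (hnL : ∀ U : Finset (Fin N), (∀ k ∈ U, L < ‖y k‖) → (U.card : ℝ) ≤ nL) :
    (S.card : ℝ) ≤ t₀ + n₁ + n₀ + nL + 16 * (4 / α) ^ d / r₁ ^ d + 16 * (4 / α) ^ d / r₀ ^ d +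
      K * (4 / κ + 1) ^ d := by
  classical
  have hfr : Module.finrank ℝ (EuclideanSpace ℝ (Fin d)) = d := by simp
  simp only [GoodAt, ← dist_eq_norm] at hgood
  obtain ⟨-, hgood⟩ := hgood
  -- after a near point is processed, later computed elements are separated from earlier ones
  have hsep : ∀ (t : ℕ) (s : ℝ), s ≤ ρ →
      (∃ k : Fin N, (k : ℕ) < t ∧ τ' ≤ dist (y k) (y m) ∧ dist (y k) (y m) ≤ s) →
      ∀ a ∈ S, ∀ b ∈ S, t ≤ (b : ℕ) → a < b →
        energy y a - energy y m - β * s ^ 2 ≤ dist (y a) (y b) := by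
    rintro t s hs ⟨k, hkt, hk1, hk2⟩ a ha b hb htb hab
    have h1 := hS a ha b hb hab k (Fin.lt_def.2 (hkt.trans_le htb))
    have h2 := (hgood k (hτ.trans hk1)).2.2 (hk2.trans hs)
    have h3 : β * dist (y k) (y m) ^ 2 ≤ β * s ^ 2 := by gcongr
    linarith
  set T₁ := S.filter fun k : Fin N => t₀ ≤ (k : ℕ) ∧ r₁ ≤ dist (y k) (y m) ∧ dist (y k) (y m) ≤ R
  set T₂ := S.filter fun k : Fin N => t₁ ≤ (k : ℕ) ∧ r₀ ≤ dist (y k) (y m) ∧ dist (y k) (y m) ≤ R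
  set T₃ := S.filter fun k : Fin N => t₀ ≤ (k : ℕ) ∧ R ≤ dist (y k) (y m) ∧ ‖y k‖ ≤ L
  set U₀ := S.filter fun k : Fin N => dist (y k) (y m) ≤ r₀
  set U₁ := S.filter fun k : Fin N => (k : ℕ) < t₁ ∧ dist (y k) (y m) ≤ r₁
  set U₂ := S.filter fun k : Fin N => L < ‖y k‖
  set U₃ := S.filter fun k : Fin N => (k : ℕ) < t₀
  -- Position below t₀ is U₃ and norm above L is U₂. From t₀ on, T₃ covers distance at least R and
  -- T₁ covers r₁ to R. Within r₁, U₁ takes positions before t₁; afterwards T₂ covers r₀ to R and U₀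
  -- the innermost ball.
  have hcover : S ⊆ U₃ ∪ U₁ ∪ U₀ ∪ U₂ ∪ T₁ ∪ T₂ ∪ T₃ := by
    intro k hk
    simp only [U₀, U₁, U₂, U₃, T₁, T₂, T₃, Finset.mem_union, Finset.mem_filter, hk, true_and]
    by_contra! hcon
    obtain ⟨⟨⟨⟨⟨⟨h1, h2⟩, h3⟩, h4⟩, h5⟩, h6⟩, h7⟩ := hcon
    have h8 : dist (y k) (y m) < R := by
      by_contra! h
      exact absurd (h7 h1 h) (by linarith)
    have h9 : dist (y k) (y m) < r₁ := by
      by_contra! h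
      exact absurd (h5 h1 h) (by linarith)
    have h10 : t₁ ≤ (k : ℕ) := by
      by_contra! h
      exact absurd (h2 h) (by linarith)
    exact absurd (h6 h10 h3.le) (by linarith)
  have hU₃ : U₃.card ≤ t₀ := by
    have h1 : U₃.map Fin.valEmbedding ⊆ Finset.range t₀ := by
      intro k hk
      obtain ⟨j, hj, rfl⟩ := Finset.mem_map.1 hk
      exact Finset.mem_range.2 (Finset.mem_filter.1 hj).2
    simpa using Finset.card_le_card h1
  have hT₁ : (T₁.card : ℝ) ≤ 16 * (4 / α) ^ d / r₁ ^ d := by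
    have := card_le_of_quadratic_separation T₁ y (y m) (r := r₁) (R := R) (α := α)
      (by rw [hfr]; exact hd) (hr₀.trans_le hr₀₁) hα (by rw [hfr]; exact hαR)
      (fun a ha => (Finset.mem_filter.1 ha).2.2.1) (fun a ha => (Finset.mem_filter.1 ha).2.2.2) ?_
    · rwa [hfr] at this
    intro a ha b hb hab
    obtain ⟨haS, -, ha1, ha2⟩ := Finset.mem_filter.1 ha
    obtain ⟨hbS, hb1, -⟩ := Finset.mem_filter.1 hb
    have h1 := hsep t₀ s₀ hs₀ hc₀ a haS b hbS hb1 hab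
    have h2 := (hgood a (by linarith)).1 (by linarith)
    have h3 : α * r₁ ^ 2 ≤ α * dist (y a) (y m) ^ 2 := by
      have := hr₀.trans_le hr₀₁
      gcongr
    linarith
  have hT₂ : (T₂.card : ℝ) ≤ 16 * (4 / α) ^ d / r₀ ^ d := by
    have := card_le_of_quadratic_separation T₂ y (y m) (r := r₀) (R := R) (α := α)
      (by rw [hfr]; exact hd) hr₀ hα (by rw [hfr]; exact hαR)
      (fun a ha => (Finset.mem_filter.1 ha).2.2.1) (fun a ha => (Finset.mem_filter.1 ha).2.2.2) ?_
    · rwa [hfr] at this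
    intro a ha b hb hab
    obtain ⟨haS, -, ha1, ha2⟩ := Finset.mem_filter.1 ha
    obtain ⟨hbS, hb1, -⟩ := Finset.mem_filter.1 hb
    have h1 := hsep t₁ s₁ hs₁ hc₁ a haS b hbS hb1 hab
    have h2 := (hgood a (by linarith)).1 (by linarith)
    have h3 : α * r₀ ^ 2 ≤ α * dist (y a) (y m) ^ 2 := by gcongr
    linarith
  have hT₃ : (T₃.card : ℝ) ≤ K * (4 / κ + 1) ^ d := by
    have := card_le_of_linear_separation T₃ y (y m) K hR hκ
      (fun a ha => (Finset.mem_filter.1 ha).2.2.1) ?_ ?_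
    · rwa [hfr] at this
    · intro a ha
      have h1 := (Finset.mem_filter.1 ha).2.2.2
      have h2 := hm.norm_le hM hfar
      have h3 : dist (y a) (y m) ≤ ‖y a‖ + ‖y m‖ := dist_le_norm_add_norm _ _
      linarith
    intro a ha b hb hab
    obtain ⟨haS, -, ha1, ha2⟩ := Finset.mem_filter.1 ha
    obtain ⟨hbS, hb1, -⟩ := Finset.mem_filter.1 hb
    have h1 := hsep t₀ s₀ hs₀ hc₀ a haS b hbS hb1 hab
    have hg := hgood a (by linarith)
    have h3 : α * r₁ ^ 2 ≤ α * R ^ 2 := by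
      have := hr₀.trans_le hr₀₁
      gcongr
    -- The correction β s₀² is at most αR²/2, so at least half of the excess energy survives as
    -- separation.
    have h4 : α * R ^ 2 ≤ energy y a - energy y m := by
      rcases le_or_gt (dist (y a) (y m)) ρ with h | h
      · refine le_trans ?_ (hg.1 h)
        gcongr
      · refine le_trans ?_ (hg.2.1 h)
        gcongr
    -- Far out, half of the excess is at least dist/8; closer in, it is at least αR²/2, which
    -- dominates κ · 44M.
    rcases le_or_gt (44 * M) (dist (y a) (y m)) with h | h
    · have h5 := hm.quarter_dist_le hM hfar a h
      have h6 : κ * dist (y a) (y m) ≤ 1 / 8 * dist (y a) (y m) := by gcongr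
      linarith
    · have h6 : κ * dist (y a) (y m) ≤ κ * (44 * M) := by gcongr
      linarith
  have hcard := (Finset.card_le_card hcover).trans (Finset.card_union_le _ _)
  have e1 := Finset.card_union_le (U₃ ∪ U₁ ∪ U₀ ∪ U₂ ∪ T₁) T₂
  have e2 := Finset.card_union_le (U₃ ∪ U₁ ∪ U₀ ∪ U₂) T₁
  have e3 := Finset.card_union_le (U₃ ∪ U₁ ∪ U₀) U₂
  have e4 := Finset.card_union_le (U₃ ∪ U₁) U₀
  have e5 := Finset.card_union_le U₃ U₁
  have e6 : S.card ≤ U₃.card + U₁.card + U₀.card + U₂.card + T₁.card + T₂.card + T₃.card := by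
    omega
  have e7 : (S.card : ℝ) ≤ U₃.card + U₁.card + U₀.card + U₂.card + T₁.card + T₂.card + T₃.card := by
    exact_mod_cast e6
  have e8 : (U₃.card : ℝ) ≤ t₀ := by exact_mod_cast hU₃
  have e9 := hn₁ U₁ fun k hk => (Finset.mem_filter.1 hk).2
  have e10 := hn₀ U₀ fun k hk => (Finset.mem_filter.1 hk).2
  have e11 := hnL U₂ fun k hk => (Finset.mem_filter.1 hk).2
  linarith

theorem numComputed_le {X : Type*} [PseudoMetricSpace X] (x : Fin N → X)
    (σ : Equiv.Perm (Fin N)) : numComputed x σ ≤ N := by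
  exact (Finset.card_le_univ (run x σ).computed).trans_eq (Fintype.card_fin N)

/-- Bounding the expected number of computed elements by its bound `B` outside of an event. -/
theorem expectedComputed_le [IsProbabilityMeasure (law f)]
    (Bad : Set (Fin N → EuclideanSpace ℝ (Fin d))) (B : ℝ)
    (h : ∀ (x : Fin N → EuclideanSpace ℝ (Fin d)) (σ : Equiv.Perm (Fin N)), x ∘ σ ∉ Bad →
      (numComputed x σ : ℝ) ≤ B) :
    expectedComputed f N ≤ ENNReal.ofReal B + N * sampleLaw f N Bad := by
  have : IsProbabilityMeasure (sampleLaw f N) := by unfold sampleLaw; infer_instance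
  -- The bad event need not be measurable, so it is replaced by a measurable hull of the same
  -- measure.
  set D := toMeasurable (sampleLaw f N) Bad
  have hD : MeasurableSet D := measurableSet_toMeasurable _ _
  let F : (Fin N → EuclideanSpace ℝ (Fin d)) → ℝ≥0∞ := fun x =>
    ENNReal.ofReal B + N * D.indicator 1 x
  have hF : Measurable F := ((measurable_one.indicator hD).const_mul _).const_add _
  have hle : ∀ (x : Fin N → EuclideanSpace ℝ (Fin d)) (σ : Equiv.Perm (Fin N)),
      (numComputed x σ : ℝ≥0∞) ≤ F (x ∘ σ) := by
    intro x σ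
    by_cases hx : x ∘ σ ∈ Bad
    · have h1 : D.indicator (1 : (Fin N → EuclideanSpace ℝ (Fin d)) → ℝ≥0∞) (x ∘ σ) = 1 :=
        Set.indicator_of_mem (subset_toMeasurable (sampleLaw f N) Bad hx) _
      simp only [F, h1, mul_one]
      exact le_add_left (by exact_mod_cast numComputed_le x σ)
    · refine le_add_right ?_
      rw [← ENNReal.ofReal_natCast]
      exact ENNReal.ofReal_le_ofReal (h x σ hx)
  have hFint : ∫⁻ x, F x ∂(sampleLaw f N) = ENNReal.ofReal B + N * sampleLaw f N Bad := by
    simp only [F]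
    rw [lintegral_add_left measurable_const, lintegral_const_mul _ (measurable_one.indicator hD),
      lintegral_indicator_one hD, lintegral_const, measure_univ, mul_one, measure_toMeasurable]
  have hperm : ∀ σ : Equiv.Perm (Fin N), MeasurePreserving
      (fun x : Fin N → EuclideanSpace ℝ (Fin d) => x ∘ σ) (sampleLaw f N) (sampleLaw f N) :=
    fun σ => measurePreserving_comp_perm (law f) σ
  unfold expectedComputed
  calc ∫⁻ x, (∑ σ : Equiv.Perm (Fin N), (numComputed x σ : ℝ≥0∞)) / (N.factorial : ℝ≥0∞)
        ∂(sampleLaw f N)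
      ≤ ∫⁻ x, (N.factorial : ℝ≥0∞)⁻¹ * ∑ σ : Equiv.Perm (Fin N), F (x ∘ σ) ∂(sampleLaw f N) := by
        refine lintegral_mono fun x => ?_
        rw [ENNReal.div_eq_inv_mul]
        exact mul_le_mul_right (Finset.sum_le_sum fun σ _ => hle x σ) _
    _ = (N.factorial : ℝ≥0∞)⁻¹ * ∑ σ : Equiv.Perm (Fin N),
          ∫⁻ x, F (x ∘ σ) ∂(sampleLaw f N) := by
        have hm : ∀ σ : Equiv.Perm (Fin N),
            Measurable fun x : Fin N → EuclideanSpace ℝ (Fin d) => F (x ∘ σ) :=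
          fun σ => hF.comp (hperm σ).measurable
        rw [lintegral_const_mul _ (Finset.measurable_fun_sum _ fun σ _ => hm σ),
          lintegral_finsetSum _ fun σ _ => hm σ]
    _ = ∫⁻ x, F x ∂(sampleLaw f N) := by
        rw [Finset.sum_congr rfl fun σ _ => (hperm σ).lintegral_comp hF, Finset.sum_const,
          Finset.card_univ, Fintype.card_perm, Fintype.card_fin, nsmul_eq_mul, ← mul_assoc,
          ENNReal.inv_mul_cancel (by exact_mod_cast N.factorial_ne_zero)
            (ENNReal.natCast_ne_top _), one_mul]
    _ = _ := hFint

theorem measurableSet_dist_le (r : ℝ) : MeasurableSet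
    {q : EuclideanSpace ℝ (Fin d) × EuclideanSpace ℝ (Fin d) | dist q.2 q.1 ≤ r} :=
  measurableSet_le (measurable_snd.dist measurable_fst) measurable_const

theorem measurableSet_annulus (r s : ℝ) : MeasurableSet
    {q : EuclideanSpace ℝ (Fin d) × EuclideanSpace ℝ (Fin d) |
      dist q.2 q.1 ≤ s ∧ ¬ dist q.2 q.1 < r} :=
  (measurableSet_dist_le s).inter
    (measurableSet_lt (measurable_snd.dist measurable_fst) measurable_const).compl

theorem measurableSet_far (r : ℝ) : MeasurableSet
    {q : EuclideanSpace ℝ (Fin d) × EuclideanSpace ℝ (Fin d) | r < ‖q.2‖} :=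
  measurableSet_lt measurable_const measurable_snd.norm

/-- The expected number of computed elements for given radii and processing times. -/
theorem expectedComputed_le_of_radii (hd : 1 ≤ d) (hfm : Measurable f) (hf0 : ∀ x, 0 ≤ f x)
    (hf1 : ∫⁻ x, ENNReal.ofReal (f x) = 1) (hint : Integrable fun x => ‖x‖ * f x)
    {α β ρ δ₀ δ₁ τ τ' R r₀ r₁ s₀ s₁ M κ L h₀ h₁ hL : ℝ} {t₀ t₁ K : ℕ}
    (hα : 0 < α) (hβ : 0 < β) (hδ₀ : 0 < δ₀) (hδ₁ : 0 < δ₁) (hR : 0 < R) (hRρ : R ≤ ρ)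
    (hαR : α * R * d ≤ 4) (hτ : τ ≤ τ') (hτ0 : 0 ≤ τ') (hr₀ : 0 < r₀) (hτr : τ' ≤ r₀)
    (hr₀₁ : r₀ ≤ r₁)
    (hr₁ : r₁ ≤ R) (hs₀ : s₀ ≤ ρ) (hs₁ : s₁ ≤ ρ) (hτs₀ : 2 * τ' ^ d ≤ s₀ ^ d)
    (hτs₁ : 2 * τ' ^ d ≤ s₁ ^ d) (hs₀0 : 0 < s₀) (hs₁0 : 0 < s₁)
    (hsr₀ : β * s₀ ^ 2 ≤ α * r₁ ^ 2 / 2)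
    (hsr₁ : β * s₁ ^ 2 ≤ α * r₀ ^ 2 / 2) (ht₀ : t₀ ≤ N) (ht₁ : t₁ ≤ N)
    (hM : 16 * ∫ x, ‖x‖ * f x ≤ M) (hM0 : 0 < M) (hN : 20 ≤ N)
    (hκ : 0 < κ) (hκ8 : κ ≤ 1 / 8) (hκM : κ * (44 * M) ≤ α * R ^ 2 / 2)
    (hL0 : 0 < L) (hK : L + 6 * M < R * 2 ^ K) :
    expectedComputed f N ≤
      ENNReal.ofReal (t₀ + (h₁ + 1) + (h₀ + 1) + (hL + 1) + 16 * (4 / α) ^ d / r₁ ^ d +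
        16 * (4 / α) ^ d / r₀ ^ d + K * (4 / κ + 1) ^ d) +
      N * (sampleLaw f N (goodSamples f α β ρ δ₀ δ₁ τ N)ᶜ +
        ENNReal.ofReal (N * Real.exp (2 * (δ₁ * (unitBallVolume d * r₁ ^ d)) * t₁ - h₁)) +
        ENNReal.ofReal (N * Real.exp (2 * (δ₁ * (unitBallVolume d * r₀ ^ d)) * N - h₀)) +
        ENNReal.ofReal (N * Real.exp (2 * ((∫ x, ‖x‖ * f x) / L) * N - hL)) +
        ENNReal.ofReal (N * Real.exp (2 * (1 / 16) * N - N / 5)) +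
        ENNReal.ofReal (N * Real.exp (δ₀ * (unitBallVolume d * (s₀ ^ d / 2)) -
          δ₀ * (unitBallVolume d * (s₀ ^ d / 2)) * t₀)) +
        ENNReal.ofReal (N * Real.exp (δ₀ * (unitBallVolume d * (s₁ ^ d / 2)) -
          δ₀ * (unitBallVolume d * (s₁ ^ d / 2)) * t₁))) := by
  classical
  have hprob := isProbabilityMeasure_law hf1
  have hV := unitBallVolume_pos d
  have hr₁0 : 0 < r₁ := hr₀.trans_le hr₀₁
  have hm1 : 0 ≤ ∫ x, ‖x‖ * f x :=
    integral_nonneg fun x => mul_nonneg (norm_nonneg x) (hf0 x)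
  let I : ℕ → Finset (Fin N) := fun t => Finset.univ.filter fun k => (k : ℕ) < t
  have hI : ∀ t ≤ N, (I t).card = t := by
    intro t ht
    simp [I, Fin.card_filter_val_lt, ht]
  have E1 := measure_exists_card_le (law f) (measurableSet_dist_le r₁)
    (p := δ₁ * (unitBallVolume d * r₁ ^ d)) (h := h₁) (by positivity) (I t₁)
  have E2 := measure_exists_card_le (law f) (measurableSet_dist_le r₀)
    (p := δ₁ * (unitBallVolume d * r₀ ^ d)) (h := h₀) (by positivity)
    (Finset.univ : Finset (Fin N))
  have E3 := measure_exists_card_le (law f) (measurableSet_far L)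
    (p := (∫ x, ‖x‖ * f x) / L) (h := hL) (by positivity) (Finset.univ : Finset (Fin N))
  have E4 := measure_exists_card_le (law f) (measurableSet_far M)
    (p := 1 / 16) (h := N / 5) (by positivity) (Finset.univ : Finset (Fin N))
  have E5 := measure_none_le (law f) (measurableSet_annulus τ' s₀)
    (p := δ₀ * (unitBallVolume d * (s₀ ^ d / 2))) (by positivity) (I t₀)
  have E6 := measure_none_le (law f) (measurableSet_annulus τ' s₁)
    (p := δ₀ * (unitBallVolume d * (s₁ ^ d / 2))) (by positivity) (I t₁)
  rw [hI _ ht₁] at E1 E6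
  rw [hI _ ht₀] at E5
  rw [Finset.card_univ, Fintype.card_fin] at E2 E3 E4
  -- The bad event is the union of the complement of the good samples and the six events of E1 to
  -- E6, found by unification.
  refine (expectedComputed_le _ _ ?_).trans (add_le_add le_rfl (mul_le_mul_right
    ((measure_union_le _ _).trans (add_le_add ((measure_union_le _ _).trans (add_le_add
    ((measure_union_le _ _).trans (add_le_add ((measure_union_le _ _).trans (add_le_add
    ((measure_union_le _ _).trans (add_le_add ((measure_union_le _ _).trans (add_le_add
    le_rfl E1)) E2)) E3)) E4)) E5)) E6)) _))
  intro x σ hx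
  obtain ⟨S, hScard, hS⟩ := exists_computed_positions x σ
  set y := x ∘ σ
  simp only [Set.mem_union, not_or, Set.mem_compl_iff, not_not] at hx
  obtain ⟨⟨⟨⟨⟨⟨⟨m, hmed, hgood⟩, n1⟩, n2⟩, n3⟩, n4⟩, n5⟩, n6⟩ := hx
  have hup : ∀ r, 0 ≤ r → r ≤ ρ → law f (Metric.closedBall (y m) r) ≤
      ENNReal.ofReal (δ₁ * (unitBallVolume d * r ^ d)) := fun r hr hrρ =>
    law_closedBall_le hd hr hrρ hδ₁.le fun w hw => (hgood.1 w hw).2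
  -- The upper energy bound is available only at distance at least τ, so the near point is sought in
  -- an annulus; 2τ'^d ≤ s^d leaves it at least half the volume of the ball.
  have hlow : ∀ s, 0 < s → s ≤ ρ → 2 * τ' ^ d ≤ s ^ d →
      ENNReal.ofReal (δ₀ * (unitBallVolume d * (s ^ d / 2))) ≤
        law f (Metric.closedBall (y m) s \ Metric.ball (y m) τ') := by
    intro s hs hsρ hτs
    have hτd : τ' ^ d ≤ s ^ d := by
      have : 0 ≤ τ' ^ d := by positivity
      linarith
    refine (ENNReal.ofReal_le_ofReal ?_).trans (le_law_annulus hd hfm hτ0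
      (le_of_pow_le_pow_left₀ (by omega) hs.le hτd) hsρ hδ₀.le fun w hw => (hgood.1 w hw).1)
    gcongr
    linarith
  rw [← hScard]
  have hcl : ∀ (t : ℕ) (s : ℝ), 0 < s → s ≤ ρ → 2 * τ' ^ d ≤ s ^ d →
      y ∉ {y | ∃ m, ENNReal.ofReal (δ₀ * (unitBallVolume d * (s ^ d / 2))) ≤
        law f (Prod.mk (y m) ⁻¹' {q | dist q.2 q.1 ≤ s ∧ ¬ dist q.2 q.1 < τ'}) ∧
        ∀ k ∈ (I t).erase m, (y m, y k) ∉ {q | dist q.2 q.1 ≤ s ∧ ¬ dist q.2 q.1 < τ'}} →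
      ∃ k : Fin N, (k : ℕ) < t ∧ τ' ≤ dist (y k) (y m) ∧ dist (y k) (y m) ≤ s := by
    intro t s hs hsρ hτs hn
    by_contra! hcon
    refine hn ⟨m, hlow s hs hsρ hτs, fun k hk hk' => ?_⟩
    have h1 := hcon k (by simpa [I] using Finset.mem_of_mem_erase hk) (not_lt.1 hk'.2)
    exact absurd hk'.1 (not_le.2 h1)
  refine card_le_of_goodAt hd hS hmed hgood hα hβ hR hRρ hαR hτ hr₀ hτr hr₀₁ hr₁ hs₀ hs₁ hsr₀ hsr₁
    (hcl t₀ s₀ hs₀0 hs₀ hτs₀ n5) (hcl t₁ s₁ hs₁0 hs₁ hτs₁ n6) hM0.le ?_ hκ hκ8 hκM hK ?_ ?_ ?_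
  · by_contra! hcon
    refine n4 ⟨m, ?_, Finset.univ.filter fun k => M < ‖y k‖, Finset.subset_univ _, ?_, ?_⟩
    · refine (law_norm_gt_le hf0 hint hM0).trans (ENNReal.ofReal_le_ofReal ?_)
      rw [div_le_div_iff₀ hM0 (by norm_num)]
      linarith
    · intro k hk
      exact (Finset.mem_filter.1 hk).2
    -- From N = 20 on, N/5 + 1 ≤ N/4.
    · have : (20 : ℝ) ≤ N := by exact_mod_cast hN
      linarith
  · intro U hU
    by_contra! hcon
    exact n2 ⟨m, hup r₀ hr₀.le ((hr₀₁.trans hr₁).trans hRρ), U, Finset.subset_univ _, hU, hcon⟩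
  · intro U hU
    by_contra! hcon
    refine n1 ⟨m, hup r₁ hr₁0.le (hr₁.trans hRρ), U, fun k hk => ?_, fun k hk => (hU k hk).2, hcon⟩
    simpa [I] using (hU k hk).1
  · intro U hU
    by_contra! hcon
    exact n3 ⟨m, law_norm_gt_le hf0 hint hL0, U, Finset.subset_univ _, hU, hcon⟩

end Counting

/-! ### Comparison of powers and exponentials -/

section Asymptotics

theorem eventually_const_mul_rpow_le (c : ℝ) {a b : ℝ} (h : a < b) :
    ∀ᶠ N : ℕ in atTop, c * (N : ℝ) ^ a ≤ (N : ℝ) ^ b := by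
  have h1 := ((tendsto_rpow_atTop (sub_pos.2 h)).comp tendsto_natCast_atTop_atTop).eventually_ge_atTop c
  filter_upwards [h1, eventually_ge_atTop 1] with N hN hN1
  have hx : (0 : ℝ) < N := by exact_mod_cast hN1
  calc c * (N : ℝ) ^ a ≤ (N : ℝ) ^ (b - a) * (N : ℝ) ^ a := by
        gcongr
        exact hN
    _ = _ := by rw [← Real.rpow_add hx]; congr 1; ring

/-- One factor N comes from the union bound over the medoid index, the other from the trivial bound
N on the count. The exponential is eventually below N^(-3). -/
theorem eventually_mul_exp_le_one (A : ℝ) {a b : ℝ} (ha : 0 < a) (hb : 0 < b) :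
    ∀ᶠ N : ℕ in atTop, (N : ℝ) * (N * Real.exp (A - a * (N : ℝ) ^ b)) ≤ 1 := by
  have h1 := ((isLittleO_exp_neg_mul_rpow_atTop ha (-3 / b)).comp_tendsto
    ((tendsto_rpow_atTop hb).comp tendsto_natCast_atTop_atTop)).bound (Real.exp_pos (-A))
  filter_upwards [h1, eventually_ge_atTop 1] with N hN hN1
  have hx : (1 : ℝ) ≤ N := by exact_mod_cast hN1
  have hx0 : (0 : ℝ) < N := by linarith
  simp only [Function.comp, Real.norm_eq_abs, abs_of_pos (Real.exp_pos _)] at hN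
  rw [abs_of_pos (by positivity), ← Real.rpow_mul hx0.le, mul_div_cancel₀ _ hb.ne'] at hN
  have h2 : Real.exp (A - a * (N : ℝ) ^ b) ≤ (N : ℝ) ^ (-3 : ℝ) := by
    have h3 := mul_le_mul_of_nonneg_left hN (Real.exp_pos A).le
    rw [← Real.exp_add, ← mul_assoc, ← Real.exp_add, add_neg_cancel, Real.exp_zero, one_mul] at h3
    refine le_of_eq_of_le ?_ h3
    congr 1
    ring
  have h4 : (N : ℝ) ^ (-3 : ℝ) = ((N : ℝ) ^ 3)⁻¹ := by
    rw [Real.rpow_neg hx0.le]; norm_cast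
  rw [h4] at h2
  calc (N : ℝ) * (N * Real.exp (A - a * (N : ℝ) ^ b)) ≤ N * (N * ((N : ℝ) ^ 3)⁻¹) := by gcongr
    _ = 1 / N := by field_simp
    _ ≤ 1 := by rw [div_le_one hx0]; exact hx

theorem rpow_neg_div_pow {x : ℝ} (hx : 0 ≤ x) {d : ℕ} (hd : 1 ≤ d) (a : ℝ) :
    (x ^ (-(a / d))) ^ d = x ^ (-a) := by
  have : (d : ℝ) ≠ 0 := by positivity
  rw [← Real.rpow_natCast, ← Real.rpow_mul hx]
  congr 1
  field_simp

theorem rpow_neg_sq {x : ℝ} (hx : 0 ≤ x) (a : ℝ) : (x ^ (-a)) ^ 2 = x ^ (-(2 * a)) := by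
  rw [← Real.rpow_natCast, ← Real.rpow_mul hx]
  congr 1
  push_cast
  ring

end Asymptotics

end Trimed

/-! ### Choice of radii and times, and the final estimate -/

set_option maxHeartbeats 1000000 in
theorem mainTheorem3 :
    ∃ C : ℝ, 0 < C ∧
      ∀ (d : ℕ) (_ : 1 ≤ d)
        (f : EuclideanSpace ℝ (Fin d) → ℝ) (_ : Measurable f) (_ : ∀ x, 0 ≤ f x)
        (_ : ∫⁻ x, ENNReal.ofReal (f x) = 1)
        (_ : Integrable fun x => ‖x‖ * f x)
        (α β ρ δ₀ δ₁ : ℝ) (_ : 0 < α) (_ : 0 < β) (_ : 0 < ρ) (_ : 0 < δ₀) (_ : 0 < δ₁)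
        (τ : ℕ → ℝ) (_ : ∀ N : ℕ, 1 ≤ N → τ N ≤ (N : ℝ) ^ (-(2 / (3 * (d : ℝ)))))
        (_ : Trimed.WHP f fun N => Trimed.goodSamples f α β ρ δ₀ δ₁ (τ N) N),
        ∀ᶠ N : ℕ in atTop,
          Trimed.expectedComputed f N ≤
            ENNReal.ofReal
              (C * (Trimed.unitBallVolume d * δ₁ + d * (4 / α) ^ d) * (N : ℝ) ^ (1 / 2 : ℝ)) := by
  -- The terms of order N^(1/2) account for 16, and all lower-order terms together for 1.
  refine ⟨17, by norm_num, ?_⟩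
  intro d hd f hfm hf0 hf1 hint α β ρ δ₀ δ₁ hα hβ hρ hδ₀ hδ₁ τ hτ hwhp
  obtain ⟨K, hK⟩ := hwhp
  have hd0 : (0 : ℝ) < d := by exact_mod_cast hd
  have hd1 : (1 : ℝ) ≤ d := by exact_mod_cast hd
  set V := Trimed.unitBallVolume d with hV_def
  have hV : 0 < V := Trimed.unitBallVolume_pos d
  have hm1 : 0 ≤ ∫ x, ‖x‖ * f x :=
    integral_nonneg fun x => mul_nonneg (norm_nonneg x) (hf0 x)
  set m₁ := ∫ x, ‖x‖ * f x with hm₁_def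
  -- By Markov, a point has norm above M with probability at most 1/16; the added 1 keeps M
  -- positive.
  set M : ℝ := 16 * m₁ + 1 with hM_def
  have hM0 : 0 < M := by positivity
  set R : ℝ := min ρ (4 / (α * d)) with hR_def
  have hR : 0 < R := lt_min hρ (by positivity)
  have hαR : α * R * d ≤ 4 := by
    have : R ≤ 4 / (α * d) := min_le_right _ _
    rw [le_div_iff₀ (by positivity)] at this
    linarith
  set κ : ℝ := min (1 / 8) (α * R ^ 2 / (88 * M)) with hκ_def
  have hκ : 0 < κ := lt_min (by norm_num) (by positivity)
  have hκM : κ * (44 * M) ≤ α * R ^ 2 / 2 := by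
    have : κ ≤ α * R ^ 2 / (88 * M) := min_le_right _ _
    rw [le_div_iff₀ (by positivity)] at this
    linarith
  set Q : ℝ := (4 / α) ^ d with hQ_def
  have hQ : 0 < Q := by positivity
  set c : ℝ := (4 / κ + 1) ^ d with hc_def
  have hc : 0 < c := by positivity
  set D : ℝ := V * δ₁ + d * Q with hD_def
  have hD : 0 < D := by positivity
  -- W collects the coefficients of all terms of order at most N^(9/20); its 9 is three from the
  -- counts h + 1 and six from the exponential tails.
  set W : ℝ := 2 * (1 + 3 * c) + 2 + 16 * Q + 9 + |K| with hW_def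
  have hW : 0 < W := by positivity
  have ev := @Trimed.eventually_const_mul_rpow_le
  have div_lt : ∀ {a b : ℝ}, b < a → -(a / d) < -(b / d) := fun h =>
    neg_lt_neg (div_lt_div_of_pos_right h hd0)
  filter_upwards [eventually_ge_atTop 20,
    ev (1 / R) (show -((1 / 5 : ℝ) / d) < 0 from neg_neg_of_pos (by positivity)),
    ev (1 / ρ) (show -((3 / 10 : ℝ) / d) < 0 from neg_neg_of_pos (by positivity)),
    ev (1 / ρ) (show -((11 / 20 : ℝ) / d) < 0 from neg_neg_of_pos (by positivity)),
    ev 2 (show (-(2 / 3) : ℝ) < -(3 / 10) by norm_num),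
    ev 2 (show (-(2 / 3) : ℝ) < -(11 / 20) by norm_num),
    ev (2 * β / α) (show -(2 * ((3 / 10 : ℝ) / d)) < -(2 * ((1 / 5 : ℝ) / d)) by
      have := @div_lt (3 / 10) (1 / 5) (by norm_num); linarith),
    ev (2 * β / α) (show -(2 * ((11 / 20 : ℝ) / d)) < -(2 * ((1 / 2 : ℝ) / d)) by
      have := @div_lt (11 / 20) (1 / 2) (by norm_num); linarith),
    ev (8 * (1 + 6 * M) / R) (show (1 : ℝ) < 6 / 5 by norm_num),
    ev (8 * (δ₁ * V)) (show (2 / 5 : ℝ) < 9 / 20 by norm_num),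
    ev (W / D) (show (9 / 20 : ℝ) < 1 / 2 by norm_num),
    Trimed.eventually_mul_exp_le_one 0 (a := 1 / 2) (b := 9 / 20) (by norm_num) (by norm_num),
    Trimed.eventually_mul_exp_le_one 0 (a := 2 * (δ₁ * V)) (b := 1 / 2) (by positivity)
      (by norm_num),
    Trimed.eventually_mul_exp_le_one (2 * m₁) (a := 1) (b := 9 / 20) (by norm_num) (by norm_num),
    Trimed.eventually_mul_exp_le_one 0 (a := 3 / 40) (b := 1) (by norm_num) (by norm_num),
    Trimed.eventually_mul_exp_le_one (δ₀ * V) (a := δ₀ * V / 2) (b := 1 / 10) (by positivity)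
      (by norm_num),
    Trimed.eventually_mul_exp_le_one (δ₀ * V) (a := δ₀ * V / 2) (b := 1 / 20) (by positivity)
      (by norm_num)]
    with N hN a1 a2 a3 a4 a5 a6 a7 a8 a9 a10 b1 b2 b3 b4 b5 b6
  have hN1 : 1 ≤ N := by omega
  have hx1 : (1 : ℝ) ≤ N := by exact_mod_cast hN1
  have hx0 : (0 : ℝ) < N := by linarith
  specialize hK N hN1
  specialize hτ N hN1
  set x : ℝ := (N : ℝ) with hx_def
  have mono : ∀ {a b : ℝ}, a ≤ b → x ^ a ≤ x ^ b := fun h =>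
    Real.rpow_le_rpow_of_exponent_le hx1 h
  have hp1 : ∀ {a : ℝ}, 0 ≤ a → 1 ≤ x ^ a := fun h => Real.one_le_rpow hx1 h
  set t₀ := ⌈x ^ (2 / 5 : ℝ)⌉₊ with ht₀_def
  set t₁ := ⌈x ^ (3 / 5 : ℝ)⌉₊ with ht₁_def
  have ht₀lo : x ^ (2 / 5 : ℝ) ≤ t₀ := Nat.le_ceil _
  have ht₁lo : x ^ (3 / 5 : ℝ) ≤ t₁ := Nat.le_ceil _
  have ht₀hi : (t₀ : ℝ) ≤ 2 * x ^ (2 / 5 : ℝ) := by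
    have h1 := (Nat.ceil_lt_add_one (show 0 ≤ x ^ (2 / 5 : ℝ) by positivity)).le
    have h2 := @hp1 (2 / 5) (by norm_num)
    linarith
  have ht₁hi : (t₁ : ℝ) ≤ 2 * x ^ (3 / 5 : ℝ) := by
    have h1 := (Nat.ceil_lt_add_one (show 0 ≤ x ^ (3 / 5 : ℝ) by positivity)).le
    have h2 := @hp1 (3 / 5) (by norm_num)
    linarith
  have hceil : ∀ a : ℝ, a ≤ 1 → ⌈x ^ a⌉₊ ≤ N := by
    intro a ha
    refine Nat.ceil_le.2 ?_
    simpa using mono ha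
  have radd : ∀ a b : ℝ, x ^ a * x ^ b = x ^ (a + b) := fun a b => (Real.rpow_add hx0 a b).symm
  have rdiv : ∀ a : ℝ, 16 * Q / x ^ (-a) = 16 * Q * x ^ a := by
    intro a
    rw [Real.rpow_neg hx0.le, div_inv_eq_mul]
  have p1 := Trimed.rpow_neg_div_pow hx0.le hd (1 / 5)
  have p2 := Trimed.rpow_neg_div_pow hx0.le hd (1 / 2)
  have p3 := Trimed.rpow_neg_div_pow hx0.le hd (3 / 10)
  have p4 := Trimed.rpow_neg_div_pow hx0.le hd (11 / 20)
  have p5 := Trimed.rpow_neg_div_pow hx0.le hd (2 / 3)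
  have small : ∀ {B a : ℝ}, 0 < B → 1 / B * x ^ a ≤ x ^ (0 : ℝ) → x ^ a ≤ B := by
    intro B a hB h
    rw [Real.rpow_zero, one_div, inv_mul_le_iff₀ hB, mul_one] at h
    exact h
  have quad : ∀ {a b : ℝ}, 2 * β / α * x ^ (-(2 * a)) ≤ x ^ (-(2 * b)) →
      β * (x ^ (-a)) ^ 2 ≤ α * (x ^ (-b)) ^ 2 / 2 := by
    intro a b h
    rw [Trimed.rpow_neg_sq hx0.le, Trimed.rpow_neg_sq hx0.le]
    rw [div_mul_eq_mul_div, div_le_iff₀ hα] at h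
    linarith
  -- The d-th powers of s₀ and s₁ are N^(-3/10) and N^(-11/20). Against t₀ ≈ N^(2/5) and t₁ ≈
  -- N^(3/5) this gives N^(1/10) and N^(1/20) expected near points up to constants, so absence is
  -- exponentially unlikely. Also s₀ and s₁ are of smaller order than r₁ and r₀, and τ' is below
  -- both. The value of h₀ is twice the Chernoff exponent 2δ₁V N^(1/2), leaving an exponential
  -- margin.
  have main := Trimed.expectedComputed_le_of_radii (f := f) (N := N) (τ := τ N)
    (τ' := x ^ (-((2 / 3 : ℝ) / d))) (R := R) (r₀ := x ^ (-((1 / 2 : ℝ) / d)))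
    (r₁ := x ^ (-((1 / 5 : ℝ) / d))) (s₀ := x ^ (-((3 / 10 : ℝ) / d)))
    (s₁ := x ^ (-((11 / 20 : ℝ) / d))) (M := M) (κ := κ) (L := x) (h₀ := 4 * (δ₁ * V) * x ^ (1 / 2 : ℝ))
    (h₁ := x ^ (9 / 20 : ℝ)) (hL := x ^ (9 / 20 : ℝ)) (t₀ := t₀) (t₁ := t₁) (K := 3 * t₀)
    hd hfm hf0 hf1 hint hα hβ hδ₀ hδ₁ hR (min_le_left _ _) hαR
    (hτ.trans_eq (by congr 2; field_simp)) (by positivity) (by positivity)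
    (mono (div_lt (by norm_num)).le) (mono (div_lt (by norm_num)).le) (small hR a1) (small hρ a2)
    (small hρ a3) (by rw [p5, p3]; exact a4) (by rw [p5, p4]; exact a5) (by positivity)
    (by positivity) (quad a6) (quad a7) (hceil _ (by norm_num)) (hceil _ (by norm_num))
    (by linarith) hM0 hN hκ (min_le_left _ _) hκM hx0 ?_
  · refine main.trans ?_
    rw [p1, p2, p3, p4, rdiv, rdiv]
    have e0 : (N : ℝ≥0∞) * Trimed.sampleLaw f N
        (Trimed.goodSamples f α β ρ δ₀ δ₁ (τ N) N)ᶜ ≤ ENNReal.ofReal |K| := by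
      refine (mul_le_mul_right hK _).trans ?_
      rw [← ENNReal.ofReal_natCast, ← ENNReal.ofReal_mul hx0.le, mul_div_cancel₀ _ hx0.ne']
      exact ENNReal.ofReal_le_ofReal (le_abs_self K)
    have eexp : ∀ {u v : ℝ}, u ≤ v → x * (x * Real.exp v) ≤ 1 →
        (N : ℝ≥0∞) * ENNReal.ofReal (N * Real.exp u) ≤ ENNReal.ofReal 1 := by
      intro u v huv h
      rw [← ENNReal.ofReal_natCast, ← ENNReal.ofReal_mul hx0.le]
      refine ENNReal.ofReal_le_ofReal (le_trans ?_ h)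
      gcongr
    have q1 : x ^ (-(1 / 5) : ℝ) * t₁ ≤ 2 * x ^ (2 / 5 : ℝ) := by
      calc x ^ (-(1 / 5) : ℝ) * t₁ ≤ x ^ (-(1 / 5) : ℝ) * (2 * x ^ (3 / 5 : ℝ)) := by gcongr
        _ = 2 * (x ^ (-(1 / 5) : ℝ) * x ^ (3 / 5 : ℝ)) := by ring
        _ = _ := by rw [radd]; norm_num
    have q2 : x ^ (-(1 / 2) : ℝ) * x = x ^ (1 / 2 : ℝ) := by
      conv_lhs => rw [← Real.rpow_one x, ← Real.rpow_mul hx0.le, one_mul, radd]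
      norm_num
    have q5 : x ^ (1 / 10 : ℝ) ≤ x ^ (-(3 / 10) : ℝ) * t₀ := by
      calc x ^ (1 / 10 : ℝ) = x ^ (-(3 / 10) : ℝ) * x ^ (2 / 5 : ℝ) := by rw [radd]; norm_num
        _ ≤ _ := by gcongr
    have q6 : x ^ (1 / 20 : ℝ) ≤ x ^ (-(11 / 20) : ℝ) * t₁ := by
      calc x ^ (1 / 20 : ℝ) = x ^ (-(11 / 20) : ℝ) * x ^ (3 / 5 : ℝ) := by rw [radd]; norm_num
        _ ≤ _ := by gcongr
    have le1 : ∀ {a : ℝ}, 0 ≤ a → x ^ (-a) ≤ 1 := fun h => by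
      simpa using mono (neg_nonpos.2 h)
    have hδV : 0 < δ₁ * V := by positivity
    have hδ₀V : 0 < δ₀ * V := by positivity
    have f1 := eexp (u := 2 * (δ₁ * (V * x ^ (-(1 / 5) : ℝ))) * t₁ - x ^ (9 / 20 : ℝ)) (by
      have := mul_le_mul_of_nonneg_left q1 hδV.le
      linarith) b1
    have f2 := eexp (u := 2 * (δ₁ * (V * x ^ (-(1 / 2) : ℝ))) * x -
      4 * (δ₁ * V) * x ^ (1 / 2 : ℝ)) (by
        rw [← q2]; exact le_of_eq (by ring)) b2
    have f3 := eexp (u := 2 * (m₁ / x) * x - x ^ (9 / 20 : ℝ)) (by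
      rw [mul_assoc, div_mul_cancel₀ _ hx0.ne', one_mul]) b3
    have f4 := eexp (u := 2 * (1 / 16) * x - x / 5) (by
      rw [Real.rpow_one]; linarith) b4
    have f5 := eexp (u := δ₀ * (V * (x ^ (-(3 / 10) : ℝ) / 2)) -
      δ₀ * (V * (x ^ (-(3 / 10) : ℝ) / 2)) * t₀) (by
        have h1 := mul_le_mul_of_nonneg_left q5 hδ₀V.le
        have h2 := mul_le_mul_of_nonneg_left (@le1 (3 / 10) (by norm_num)) hδ₀V.le
        linarith) b5
    have f6 := eexp (u := δ₀ * (V * (x ^ (-(11 / 20) : ℝ) / 2)) -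
      δ₀ * (V * (x ^ (-(11 / 20) : ℝ) / 2)) * t₁) (by
        have h1 := mul_le_mul_of_nonneg_left q6 hδ₀V.le
        have h2 := mul_le_mul_of_nonneg_left (@le1 (11 / 20) (by norm_num)) hδ₀V.le
        linarith) b6
    have split : ∀ {n a b A B : ℝ≥0∞}, n * a ≤ A → n * b ≤ B → n * (a + b) ≤ A + B :=
      fun ha hb => (mul_add _ _ _).trans_le (add_le_add ha hb)
    refine (add_le_add le_rfl (split (split (split (split (split (split
      e0 f1) f2) f3) f4) f5) f6)).trans ?_
    rw [← ENNReal.ofReal_add (by positivity) (by norm_num),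
      ← ENNReal.ofReal_add (by positivity) (by norm_num),
      ← ENNReal.ofReal_add (by positivity) (by norm_num),
      ← ENNReal.ofReal_add (by positivity) (by norm_num),
      ← ENNReal.ofReal_add (by positivity) (by norm_num),
      ← ENNReal.ofReal_add (by positivity) (by norm_num),
      ← ENNReal.ofReal_add (by positivity) (by positivity)]
    refine ENNReal.ofReal_le_ofReal ?_
    rw [div_mul_eq_mul_div, div_le_iff₀ hD] at a10
    have g1 : (t₀ : ℝ) ≤ 2 * x ^ (9 / 20 : ℝ) :=
      ht₀hi.trans (by gcongr 2 * ?_; exact mono (by norm_num))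
    have g2 : (t₀ : ℝ) * c ≤ 2 * x ^ (9 / 20 : ℝ) * c := by gcongr
    have g3 : 16 * Q * x ^ (1 / 5 : ℝ) ≤ 16 * Q * x ^ (9 / 20 : ℝ) := by
      gcongr 16 * Q * ?_; exact mono (by norm_num)
    have g4 := @hp1 (9 / 20) (by norm_num)
    have g5 : |K| * 1 ≤ |K| * x ^ (9 / 20 : ℝ) := by gcongr
    have g6 : (4 * (δ₁ * V) + 16 * Q) * x ^ (1 / 2 : ℝ) ≤ 16 * D * x ^ (1 / 2 : ℝ) := by
      gcongr
      have : 1 * Q ≤ d * Q := by gcongr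
      rw [hD_def]
      linarith
    push_cast
    rw [hW_def] at a10
    linarith
  -- Logarithmically many shells would do, but 3t₀ = O(N^(2/5)) is already negligible, and 2^(3t₀) ≥
  -- t₀³ ≥ N^(6/5) exceeds the required (N + 6M)/R.
  · have h1 : (x ^ (2 / 5 : ℝ)) ^ 3 = x ^ (6 / 5 : ℝ) := by
      rw [← Real.rpow_natCast, ← Real.rpow_mul hx0.le]; norm_num
    have h2 : (t₀ : ℝ) ≤ 2 ^ t₀ := by exact_mod_cast t₀.lt_two_pow_self.le
    have h3 : x ^ (6 / 5 : ℝ) ≤ 2 ^ (3 * t₀) := by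
      rw [← h1, mul_comm, pow_mul]
      exact pow_le_pow_left₀ (by positivity) (ht₀lo.trans h2) 3
    rw [Real.rpow_one, div_mul_eq_mul_div, div_le_iff₀ hR] at a8
    have h4 : R * x ^ (6 / 5 : ℝ) ≤ R * 2 ^ (3 * t₀) := by gcongr
    have h5 : M * 1 ≤ M * x := by gcongr
    nlinarith
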